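/- Let $m\ge 1$ and $k\ge 0$ be integers. Let $\mathbb F_{2^m}$ be the field with $2^m$ elements, identified with $\mathbb F_2^{\,m}$ by an arbitrary fixed $\mathbb F_2$-basis, and let $V=\mathbb R[\mathbb F_{2^m}]$ be the real vector space with basis $(x_f)_{f\in\mathbb F_{2^m}}$, so that $V\cong\bigotimes^m\mathbb R^2$ with $\mathbb R^2=\mathbb R[\mathbb F_2]$. Let $E(1)=\left\langle\begin{pmatrix}0&1\\1&0\end{pmatrix},\begin{pmatrix}1&0\\0&-1\end{pmatrix}\right\rangle\subset O(2,\mathbb R)$, let $E(m)=E(1)^{\otimes m}\subset O(2^m,\mathbb R)$, and let the real Clifford group $\mathcal C_m$ of genus $m$ be the normalizer of $E(m)$ in $O(2^m,\mathbb R)$. It acts on the polynomial ring $\mathbb R[x_f\mid f\in\mathbb F_{2^m}]$ by extending its linear action on $V$ to algebra automorphisms. A binary self-dual code of length $N$ is a subspace $C\subseteq\mathbb F_2^N$ with $C=C^\perp$ for the standard dot product; two such codes are equivalent if a permutation of the coordinates maps one onto the other. For such $C$ put $C(m)=C\otimes_{\mathbb F_2}\mathbb F_{2^m}\subseteq\mathbb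 F_{2^m}^N$, with complete weight enumerator $$\operatorname{cwe}(C(m))=\sum_{c\in C(m)}\ \prod_{f\in\mathbb F_{2^m}}x_f^{a_f(c)},$$ where $a_f(c)$ is the number of components of $c$ equal to $f$. Then the space of homogeneous polynomials of degree $2k$ in $\mathbb R[x_f\mid f\in\mathbb F_{2^m}]$ that are invariant under $\mathcal C_m$ is spanned by the polynomials $\operatorname{cwe}(C(m))$, where $C$ ranges over all binary self-dual codes of length $2k$. If moreover $m\ge k-1$, these polynomials form a basis of that space when $C$ ranges over the equivalence classes of binary self-dual codes of length $2k$ (equivalent codes have the same enumerator, and enumerators of inequivalent codes are linearly independent). -/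

import Mathlib

noncomputable section

namespace RealClifford

open scoped Matrix
open MvPolynomial

/-! ### The real Clifford group -/

/-- The matrix `σ₁ = (0 1; 1 0)`, rows and columns indexed by `𝔽₂ = {0, 1}`. -/
def sigmaOneMatrix : Matrix (ZMod 2) (ZMod 2) ℝ :=
  Matrix.of fun i j => if i = j then 0 else 1

/-- The matrix `σ₂ = (1 0; 0 -1)`, rows and columns indexed by `𝔽₂ = {0, 1}`. -/
def sigmaTwoMatrix : Matrix (ZMod 2) (ZMod 2) ℝ :=
  Matrix.diagonal fun i => if i = 0 then 1 else -1

theorem sigmaOneMatrix_mem : sigmaOneMatrix ∈ Matrix.orthogonalGroup (ZMod 2) ℝ := by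
  rw [Matrix.mem_orthogonalGroup_iff]
  have huniv : (Finset.univ : Finset (ZMod 2)) = {0, 1} := by decide
  have h2 : ∀ i : ZMod 2, i = 0 ∨ i = 1 := by decide
  ext i j
  rw [Matrix.mul_apply, huniv, Finset.sum_pair (by decide)]
  rcases h2 i with rfl | rfl <;> rcases h2 j with rfl | rfl <;> simp [sigmaOneMatrix]

theorem sigmaTwoMatrix_mem : sigmaTwoMatrix ∈ Matrix.orthogonalGroup (ZMod 2) ℝ := by
  rw [Matrix.mem_orthogonalGroup_iff, sigmaTwoMatrix, Matrix.diagonal_transpose,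
    Matrix.diagonal_mul_diagonal, ← Matrix.diagonal_one]
  congr 1
  funext i
  by_cases hi : i = 0 <;> simp [hi]

/-- `σ₁` as an element of `O(2, ℝ)`. -/
def sigmaOne : Matrix.orthogonalGroup (ZMod 2) ℝ := ⟨sigmaOneMatrix, sigmaOneMatrix_mem⟩

/-- `σ₂` as an element of `O(2, ℝ)`. -/
def sigmaTwo : Matrix.orthogonalGroup (ZMod 2) ℝ := ⟨sigmaTwoMatrix, sigmaTwoMatrix_mem⟩

/-- The group `E(1) = ⟨σ₁, σ₂⟩` (dihedral of order 8). -/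
def extraspecialOne : Subgroup (Matrix.orthogonalGroup (ZMod 2) ℝ) :=
  Subgroup.closure {sigmaOne, sigmaTwo}

/-- The tensor (Kronecker) product `A₁ ⊗ ⋯ ⊗ A_m` of `2 × 2` matrices, acting on
`⊗^m ℝ² = ℝ[𝔽₂^m]`; the basis vector `v` of `ℝ[𝔽₂^m]` is `y_{v₁} ⊗ ⋯ ⊗ y_{v_m}`. -/
def tensorMatrix {m : ℕ} (A : Fin m → Matrix (ZMod 2) (ZMod 2) ℝ) :
    Matrix (Fin m → ZMod 2) (Fin m → ZMod 2) ℝ :=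
  Matrix.of fun v w => ∏ i, A i (v i) (w i)

theorem tensorMatrix_mul {m : ℕ} (A B : Fin m → Matrix (ZMod 2) (ZMod 2) ℝ) :
    tensorMatrix A * tensorMatrix B = tensorMatrix fun i => A i * B i := by
  ext v w
  simp only [tensorMatrix, Matrix.mul_apply, Matrix.of_apply, ← Finset.prod_mul_distrib]
  rw [Finset.prod_univ_sum, Fintype.piFinset_univ]

theorem tensorMatrix_one {m : ℕ} :
    tensorMatrix (fun _ : Fin m => (1 : Matrix (ZMod 2) (ZMod 2) ℝ)) = 1 := by
  ext v w
  simp only [tensorMatrix, Matrix.of_apply, Matrix.one_apply]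
  by_cases h : v = w
  · simp [h]
  · obtain ⟨i, hi⟩ := Function.ne_iff.mp h
    rw [if_neg h]
    exact Finset.prod_eq_zero (Finset.mem_univ i) (if_neg hi)

theorem tensorMatrix_mem {m : ℕ} (A : Fin m → Matrix.orthogonalGroup (ZMod 2) ℝ) :
    tensorMatrix (fun i => (A i : Matrix (ZMod 2) (ZMod 2) ℝ)) ∈
      Matrix.orthogonalGroup (Fin m → ZMod 2) ℝ := by
  rw [Matrix.mem_orthogonalGroup_iff]
  have hs : (tensorMatrix fun i => (A i : Matrix (ZMod 2) (ZMod 2) ℝ))ᵀ =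
      tensorMatrix fun i => (A i : Matrix (ZMod 2) (ZMod 2) ℝ)ᵀ := rfl
  rw [hs, tensorMatrix_mul, ← tensorMatrix_one]
  congr 1
  funext i
  exact (Matrix.mem_orthogonalGroup_iff _ _).mp (A i).2

/-- The homomorphism `O(2, ℝ)^m → O(2^m, ℝ)`, `(A₁, …, A_m) ↦ A₁ ⊗ ⋯ ⊗ A_m`. -/
def tensorHom (m : ℕ) :
    (Fin m → Matrix.orthogonalGroup (ZMod 2) ℝ) →* Matrix.orthogonalGroup (Fin m → ZMod 2) ℝ where
  toFun A := ⟨tensorMatrix fun i => (A i : Matrix (ZMod 2) (ZMod 2) ℝ), tensorMatrix_mem A⟩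
  map_one' := Subtype.ext tensorMatrix_one
  map_mul' _ _ := Subtype.ext (tensorMatrix_mul _ _).symm

/-- The extraspecial group `E(m) = E(1) ⊗ ⋯ ⊗ E(1)` inside `O(2^m, ℝ)`. -/
def extraspecial (m : ℕ) : Subgroup (Matrix.orthogonalGroup (Fin m → ZMod 2) ℝ) :=
  (Subgroup.pi Set.univ fun _ : Fin m => extraspecialOne).map (tensorHom m)

/-- The real Clifford group of genus `m`: the normalizer of `E(m)` in `O(2^m, ℝ)`. -/
def cliffordGroup (m : ℕ) : Subgroup (Matrix.orthogonalGroup (Fin m → ZMod 2) ℝ) :=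
  Subgroup.normalizer (extraspecial m)

/-! ### Invariant polynomials -/

/-- The action of a matrix on polynomials in variables `x_f`, `f ∈ ι`: the algebra endomorphism
extending the linear action `x_f ↦ ∑ f', A f' f • x_f'` on the space with basis `(x_f)`. -/
def matrixAct {ι : Type*} [Fintype ι] (A : Matrix ι ι ℝ) : MvPolynomial ι ℝ →ₐ[ℝ] MvPolynomial ι ℝ :=
  aeval fun f => ∑ f', C (A f' f) * X f'

/-- The space of homogeneous Clifford invariants of degree `n` and genus `m`, in the variables
`x_f`, `f ∈ K`, where `K` is the field with `2^m` elements, identified with `𝔽₂^m` through the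
basis `b`. -/
def cliffordInvariants {K : Type*} [Field K] [Fintype K] [Algebra (ZMod 2) K] {m : ℕ}
    (b : Module.Basis (Fin m) (ZMod 2) K) (n : ℕ) : Submodule ℝ (MvPolynomial K ℝ) where
  carrier := {p | p.IsHomogeneous n ∧ ∀ g ∈ cliffordGroup m,
    matrixAct ((g : Matrix (Fin m → ZMod 2) (Fin m → ZMod 2) ℝ).submatrix b.equivFun b.equivFun) p
      = p}
  zero_mem' := ⟨isHomogeneous_zero _ _ _, fun _ _ => map_zero _⟩
  add_mem' hp hq := ⟨hp.1.add hq.1, fun g hg => by rw [map_add, hp.2 g hg, hq.2 g hg]⟩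
  smul_mem' r p hp := ⟨(homogeneousSubmodule K ℝ n).smul_mem r hp.1,
    fun g hg => by rw [map_smul, hp.2 g hg]⟩

/-! ### Codes and complete weight enumerators -/

/-- The dual code `C^⊥` of a binary linear code. -/
def dualCode {N : ℕ} (C : Submodule (ZMod 2) (Fin N → ZMod 2)) :
    Submodule (ZMod 2) (Fin N → ZMod 2) where
  carrier := {x | ∀ c ∈ C, c ⬝ᵥ x = 0}
  zero_mem' c _ := dotProduct_zero c
  add_mem' hx hy c hc := by rw [dotProduct_add, hx c hc, hy c hc, add_zero]
  smul_mem' a x hx c hc := by rw [dotProduct_smul, hx c hc, smul_zero]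

/-- Binary self-dual codes of length `N`. -/
abbrev SelfDualCode (N : ℕ) : Type :=
  {C : Submodule (ZMod 2) (Fin N → ZMod 2) // dualCode C = C}

/-- Equivalence of self-dual codes: some permutation of the coordinates carries one onto the
other. -/
def codeEquivalence (N : ℕ) : Setoid (SelfDualCode N) where
  r C D := ∃ s : Equiv.Perm (Fin N), ∀ c : Fin N → ZMod 2, c ∈ C.1 ↔ c ∘ s ∈ D.1
  iseqv :=
    { refl := fun _ => ⟨1, fun _ => Iff.rfl⟩
      symm := fun {C D} ⟨s, hs⟩ => ⟨s⁻¹, fun c => by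
        rw [hs, Function.comp_assoc, ← Equiv.Perm.coe_mul, inv_mul_cancel, Equiv.Perm.coe_one,
          Function.comp_id]⟩
      trans := fun {C D F} ⟨s, hs⟩ ⟨t, ht⟩ => ⟨s * t, fun c => by
        rw [hs, ht, Function.comp_assoc, Equiv.Perm.coe_mul]⟩ }

/-- The extension of scalars `C ⊗ K ⊆ 𝔽₂^N ⊗ K = K^N` of a binary code `C`. -/
def extendScalars (K : Type*) [Field K] [Algebra (ZMod 2) K] {N : ℕ}
    (C : Submodule (ZMod 2) (Fin N → ZMod 2)) : Submodule K (Fin N → K) :=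
  (C.baseChange K).map (TensorProduct.piScalarRight (ZMod 2) K K (Fin N)).toLinearMap

open Classical in
/-- The complete weight enumerator `∑_{c ∈ D} ∏_{f ∈ K} x_f ^ a_f(c)` of a linear code `D` over a
finite field `K`, where `a_f(c)` is the number of components of `c` equal to `f`. -/
def cwe {K : Type*} [Field K] [Fintype K] {N : ℕ} (D : Submodule K (Fin N → K)) :
    MvPolynomial K ℝ :=
  ∑ c : Fin N → K with c ∈ D, ∏ f : K, X f ^ Nat.card {i : Fin N // c i = f}

end RealClifford

end

namespace RealClifford

open scoped Matrix
open MvPolynomial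

/-! Homogeneous polynomials of degree N correspond equivariantly to symmetric tensors, that is, to
symmetric functions `F` of N × m matrices over 𝔽₂. Under this correspondence cwe(C(m)) is the image
of `codeTensor m C` (`cwe_extendScalars`), so it suffices to find the invariant tensors for N = 2k.

Self-dual codes give invariants (`kron_mulVec_codeTensor`): the Pauli operators placed on the words
of C have the line through the code tensor as their common fixed space. Conjugation by a Clifford
element permutes these operators, so the element rescales the tensor. The scalar is 1, because
contracting the two halves of the tensor is invariant under orthogonal matrices and positive on code
tensors.

Conversely, let `F` be invariant. Linear substitutions, translations and quadratic signs show that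
F(M) depends only on the code generated by the columns of M and the all-ones word, and vanishes
unless this code is self-orthogonal. By Möbius inversion `F` is a combination of tensors of
admissible codes. The average T of the Hadamard transforms over all nonzero directions fixes `F`,
and maps the tensor of C to λ times itself plus a combination of tensors of larger admissible codes,
with λ < 1 if |C| < 2^k (`exists_averaged_hadamard`). Hence T - λ eliminates the smallest codes
while multiplying `F` by 1 - λ ≠ 0; iterating leaves only self-dual codes.

For independence, if k - 1 ≤ m then C is generated by the all-ones word and the columns of one
matrix M, and the monomial of M occurs in the enumerator of D only if D is equivalent to C. -/

/-! ### Kronecker products of families of matrices -/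

/-- The Kronecker product of a finite family of square matrices. -/
noncomputable def kron {ν ι : Type*} [Fintype ν] (A : ν → Matrix ι ι ℝ) : Matrix (ν → ι) (ν → ι) ℝ :=
  Matrix.of fun x y => ∏ n, A n (x n) (y n)

theorem kron_apply {ν ι : Type*} [Fintype ν] (A : ν → Matrix ι ι ℝ) (x y : ν → ι) :
    kron A x y = ∏ n, A n (x n) (y n) := rfl

theorem kron_mul {ν ι : Type*} [Fintype ν] [Fintype ι] [DecidableEq ν] (A B : ν → Matrix ι ι ℝ) :
    kron A * kron B = kron fun n => A n * B n := by
  ext x y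
  simp only [kron_apply, Matrix.mul_apply, ← Finset.prod_mul_distrib]
  rw [Finset.prod_univ_sum, Fintype.piFinset_univ]

theorem kron_one {ν ι : Type*} [Fintype ν] [DecidableEq ν] [DecidableEq ι] :
    kron (fun _ : ν => (1 : Matrix ι ι ℝ)) = 1 := by
  ext v w
  simp only [kron_apply, Matrix.one_apply]
  rw [Finset.prod_boole]
  simp [funext_iff]

/-! ### Signs and monomial matrices -/

/-- The nontrivial character of `ZMod 2`. -/
noncomputable def sign (a : ZMod 2) : ℝ := if a = 0 then 1 else -1

@[simp] theorem sign_zero : sign 0 = 1 := if_pos rfl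

@[simp] theorem sign_one : sign 1 = -1 := if_neg one_ne_zero

theorem zmod_two_cases (a : ZMod 2) : a = 0 ∨ a = 1 := by
  revert a; decide

theorem sign_add (a b : ZMod 2) : sign (a + b) = sign a * sign b := by
  have h : (1 + 1 : ZMod 2) = 0 := by decide
  rcases zmod_two_cases a with rfl | rfl <;> rcases zmod_two_cases b with rfl | rfl <;> simp [h]

theorem sign_sum {α : Type*} (s : Finset α) (f : α → ZMod 2) :
    sign (∑ i ∈ s, f i) = ∏ i ∈ s, sign (f i) := by
  classical
  induction s using Finset.induction_on with
  | empty => simp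
  | insert a s ha ih => rw [Finset.sum_insert ha, Finset.prod_insert ha, sign_add, ih]

theorem sign_injective {a b : ZMod 2} (h : sign a = sign b) : a = b := by
  rcases zmod_two_cases a with rfl | rfl <;> rcases zmod_two_cases b with rfl | rfl <;>
    first | rfl | (exfalso; norm_num at h)

/-- The signed permutation matrix sending the basis vector `w` to `sign (q w)` times the basis
vector `s w`. -/
noncomputable def monomialMatrix {ι : Type*} [DecidableEq ι] (s : Equiv.Perm ι) (q : ι → ZMod 2) :
    Matrix ι ι ℝ :=
  Matrix.of fun v w => if v = s w then sign (q w) else 0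

theorem monomialMatrix_mul {ι : Type*} [Fintype ι] [DecidableEq ι] (s t : Equiv.Perm ι)
    (q r : ι → ZMod 2) :
    monomialMatrix s q * monomialMatrix t r = monomialMatrix (s * t) fun w => q (t w) + r w := by
  ext v w
  simp [monomialMatrix, Matrix.mul_apply, sign_add]

theorem monomialMatrix_one {ι : Type*} [DecidableEq ι] :
    monomialMatrix (1 : Equiv.Perm ι) (fun _ => 0) = 1 := by
  ext v w
  simp [monomialMatrix, Matrix.one_apply]

theorem monomialMatrix_transpose {ι : Type*} [DecidableEq ι] (s : Equiv.Perm ι)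
    (q : ι → ZMod 2) :
    (monomialMatrix s q)ᵀ = monomialMatrix s⁻¹ fun w => q (s⁻¹ w) := by
  ext v w
  simp only [monomialMatrix, Matrix.transpose_apply, Matrix.of_apply]
  by_cases h : w = s v
  · simp [h]
  · rw [if_neg h, if_neg]
    rintro rfl
    exact h (by simp)

theorem monomialMatrix_mem {ι : Type*} [Fintype ι] [DecidableEq ι] (s : Equiv.Perm ι)
    (q : ι → ZMod 2) : monomialMatrix s q ∈ Matrix.orthogonalGroup ι ℝ := by
  rw [Matrix.mem_orthogonalGroup_iff, monomialMatrix_transpose, monomialMatrix_mul,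
    ← monomialMatrix_one]
  simp [CharTwo.add_self_eq_zero]

/-- The product is again a signed permutation, so each row has one nonzero entry. Evaluating at the
image of `M` avoids inverse permutations. -/
theorem kron_monomialMatrix_mulVec {ν ι : Type*} [Fintype ν] [DecidableEq ν] [Fintype ι]
    [DecidableEq ι] (s : ν → Equiv.Perm ι) (q : ν → ι → ZMod 2) (F : (ν → ι) → ℝ) (M : ν → ι) :
    (kron (fun n => monomialMatrix (s n) (q n)) *ᵥ F) (fun n => s n (M n)) =
      sign (∑ n, q n (M n)) * F M := by
  rw [Matrix.mulVec, dotProduct, Finset.sum_eq_single M]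
  · simp [kron_apply, monomialMatrix, sign_sum]
  · intro M' _ hM
    obtain ⟨n, hn⟩ := Function.ne_iff.mp hM
    rw [kron_apply, Finset.prod_eq_zero (Finset.mem_univ n), zero_mul]
    simp only [monomialMatrix, Matrix.of_apply]
    exact if_neg fun h => hn ((s n).injective h).symm
  · simp

/-! ### The extraspecial group -/

/-- The matrix `± X(a) Z(b)`. -/
noncomputable def pauli {m : ℕ} (t : ZMod 2) (a b : Fin m → ZMod 2) :
    Matrix (Fin m → ZMod 2) (Fin m → ZMod 2) ℝ :=
  monomialMatrix (Equiv.addRight a) fun w => t + b ⬝ᵥ w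

/-- The `2 × 2` matrix `± X(a) Z(b)`. -/
noncomputable def pauliOne (t a b : ZMod 2) : Matrix (ZMod 2) (ZMod 2) ℝ :=
  monomialMatrix (Equiv.addRight a) fun w => t + b * w

theorem sigmaOneMatrix_eq : sigmaOneMatrix = pauliOne 0 1 0 := by
  ext i j
  rcases zmod_two_cases i with rfl | rfl <;> rcases zmod_two_cases j with rfl | rfl <;>
    simp [sigmaOneMatrix, pauliOne, monomialMatrix, CharTwo.add_self_eq_zero]

theorem sigmaTwoMatrix_eq : sigmaTwoMatrix = pauliOne 0 0 1 := by
  ext i j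
  rcases zmod_two_cases i with rfl | rfl <;> rcases zmod_two_cases j with rfl | rfl <;>
    simp [sigmaTwoMatrix, pauliOne, monomialMatrix]

/-- Moving Z(b) past X(a') costs the sign of b a'. -/
theorem pauliOne_mul (t a b t' a' b' : ZMod 2) :
    pauliOne t a b * pauliOne t' a' b' = pauliOne (t + t' + b * a') (a + a') (b + b') := by
  rw [pauliOne, pauliOne, monomialMatrix_mul, pauliOne]
  congr 1
  · ext x
    simp [add_comm, add_left_comm]
  · funext w
    simp only [Equiv.coe_addRight]
    ring

theorem pauliOne_transpose (t a b : ZMod 2) :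
    (pauliOne t a b)ᵀ = pauliOne (t + b * a) a b := by
  rw [pauliOne, monomialMatrix_transpose, pauliOne]
  congr 1
  · ext x
    simp [CharTwo.neg_eq]
  · funext w
    simp [CharTwo.neg_eq]
    ring

theorem pauliOne_zero : pauliOne 0 0 0 = 1 := by
  rw [← monomialMatrix_one, pauliOne]
  congr 1
  · ext x
    simp
  · funext w
    simp

theorem mem_extraspecialOne_iff {A : Matrix.orthogonalGroup (ZMod 2) ℝ} :
    A ∈ extraspecialOne ↔ ∃ t a b, A.1 = pauliOne t a b := by
  constructor
  · intro h
    induction h using Subgroup.closure_induction with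
    | mem x hx =>
      rcases hx with rfl | rfl
      · exact ⟨_, _, _, sigmaOneMatrix_eq⟩
      · exact ⟨_, _, _, sigmaTwoMatrix_eq⟩
    | one => exact ⟨0, 0, 0, pauliOne_zero.symm⟩
    | mul x y _ _ hx hy =>
      obtain ⟨t, a, b, hx⟩ := hx
      obtain ⟨t', a', b', hy⟩ := hy
      exact ⟨_, _, _, by
        rw [show (x * y).1 = x.1 * y.1 from rfl, hx, hy, pauliOne_mul]⟩
    | inv x _ hx =>
      obtain ⟨t, a, b, hx⟩ := hx
      exact ⟨_, _, _, by
        rw [show (x⁻¹).1 = (x.1)ᵀ from rfl, hx, pauliOne_transpose]⟩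
  · rintro ⟨t, a, b, h⟩
    have h1 : sigmaOne ∈ extraspecialOne := Subgroup.subset_closure (Or.inl rfl)
    have h2 : sigmaTwo ∈ extraspecialOne := Subgroup.subset_closure (Or.inr rfl)
    -- (σ₁σ₂)² = -1 supplies the sign.
    have key : A = (sigmaOne * sigmaTwo * sigmaOne * sigmaTwo) ^ t.val * sigmaOne ^ a.val *
        sigmaTwo ^ b.val := by
      apply Subtype.ext
      have e1 : sigmaOne.1 = pauliOne 0 1 0 := sigmaOneMatrix_eq
      have e2 : sigmaTwo.1 = pauliOne 0 0 1 := sigmaTwoMatrix_eq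
      rw [h]
      push_cast
      rw [e1, e2]
      rcases zmod_two_cases t with rfl | rfl <;> rcases zmod_two_cases a with rfl | rfl <;>
        rcases zmod_two_cases b with rfl | rfl <;>
        simp [ZMod.val_one, pauliOne_mul, pauliOne_zero, CharTwo.add_self_eq_zero]
    rw [key]
    exact mul_mem (mul_mem (pow_mem (mul_mem (mul_mem (mul_mem h1 h2) h1) h2) _)
      (pow_mem h1 _)) (pow_mem h2 _)

theorem tensorMatrix_pauliOne {m : ℕ} (t a b : Fin m → ZMod 2) :
    tensorMatrix (fun i => pauliOne (t i) (a i) (b i)) = pauli (∑ i, t i) a b := by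
  ext v w
  simp only [tensorMatrix, pauliOne, pauli, monomialMatrix, Matrix.of_apply, Equiv.coe_addRight]
  by_cases h : v = w + a
  · subst h
    simp [sign_sum, sign_add, dotProduct, Finset.prod_mul_distrib]
  · refine Eq.trans ?_ (if_neg h).symm
    obtain ⟨i, hi⟩ := Function.ne_iff.mp h
    exact Finset.prod_eq_zero (Finset.mem_univ i) (if_neg hi)

theorem mem_extraspecial_iff {m : ℕ} (hm : 1 ≤ m)
    {g : Matrix.orthogonalGroup (Fin m → ZMod 2) ℝ} :
    g ∈ extraspecial m ↔ ∃ t a b, g.1 = pauli t a b := by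
  constructor
  · rintro ⟨A, hA, rfl⟩
    have hA' : ∀ i, A i ∈ extraspecialOne := fun i => hA i (Set.mem_univ i)
    simp only [mem_extraspecialOne_iff] at hA'
    choose t a b h using hA'
    refine ⟨∑ i, t i, a, b, ?_⟩
    rw [← tensorMatrix_pauliOne]
    exact congrArg tensorMatrix (funext h)
  · rintro ⟨t, a, b, h⟩
    -- The whole sign is put on the tensor factor 0. This needs m ≥ 1: for m = 0 the group is
    -- trivial and does not contain -1.
    refine ⟨fun i => ⟨pauliOne ((Pi.single ⟨0, hm⟩ t : Fin m → ZMod 2) i) (a i) (b i),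
      monomialMatrix_mem _ _⟩, fun i _ => mem_extraspecialOne_iff.mpr ⟨_, _, _, rfl⟩, ?_⟩
    apply Subtype.ext
    rw [h]
    exact (tensorMatrix_pauliOne _ _ _).trans (by simp)

theorem extraspecial_finite {m : ℕ} (hm : 1 ≤ m) :
    (extraspecial m : Set (Matrix.orthogonalGroup (Fin m → ZMod 2) ℝ)).Finite := by
  refine Set.Finite.of_finite_image (f := Subtype.val) ?_ Subtype.val_injective.injOn
  refine (Set.finite_range fun p : ZMod 2 × (Fin m → ZMod 2) × (Fin m → ZMod 2) =>
    pauli p.1 p.2.1 p.2.2).subset ?_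
  rintro _ ⟨g, hg, rfl⟩
  obtain ⟨t, a, b, h⟩ := (mem_extraspecial_iff hm).mp hg
  exact ⟨(t, a, b), h.symm⟩

/-! ### Elements of the Clifford group -/

/-- As E(m) is finite, an inclusion of the conjugate is an equality. -/
theorem mem_cliffordGroup_of_conj {m : ℕ} (hm : 1 ≤ m)
    {g : Matrix.orthogonalGroup (Fin m → ZMod 2) ℝ}
    (h : ∀ x ∈ extraspecial m, g * x * g⁻¹ ∈ extraspecial m) : g ∈ cliffordGroup m := by
  have : Finite (extraspecial m : Set (Matrix.orthogonalGroup (Fin m → ZMod 2) ℝ)) :=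
    extraspecial_finite hm
  exact Subgroup.mem_normalizer_fintype h

theorem pauli_mem_cliffordGroup {m : ℕ} (hm : 1 ≤ m) (t : ZMod 2) (a b : Fin m → ZMod 2) :
    (⟨pauli t a b, monomialMatrix_mem _ _⟩ : Matrix.orthogonalGroup (Fin m → ZMod 2) ℝ) ∈
      cliffordGroup m :=
  Subgroup.le_normalizer ((mem_extraspecial_iff hm).mpr ⟨t, a, b, rfl⟩)

/-- `hs` makes `s` carry translations to translations; `hq` makes the derivatives of the phase `q`,
with any linear form added, affine in `s w`. These are the two components of conjugating X(a)Z(b).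
-/
theorem monomialMatrix_mem_cliffordGroup {m : ℕ} (hm : 1 ≤ m)
    (s : Equiv.Perm (Fin m → ZMod 2)) (q : (Fin m → ZMod 2) → ZMod 2)
    (hs : ∀ a, ∃ a', ∀ w, s (w + a) = s w + a')
    (hq : ∀ a b : Fin m → ZMod 2, ∃ t b', ∀ w, q (w + a) + b ⬝ᵥ w + q w = t + b' ⬝ᵥ s w) :
    (⟨monomialMatrix s q, monomialMatrix_mem _ _⟩ :
      Matrix.orthogonalGroup (Fin m → ZMod 2) ℝ) ∈ cliffordGroup m := by
  refine mem_cliffordGroup_of_conj hm fun x hx => ?_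
  obtain ⟨t, a, b, hx⟩ := (mem_extraspecial_iff hm).mp hx
  obtain ⟨a', ha'⟩ := hs a
  obtain ⟨t', b', hb'⟩ := hq a b
  refine (mem_extraspecial_iff hm).mpr ⟨t + t', a', b', ?_⟩
  set g : Matrix.orthogonalGroup (Fin m → ZMod 2) ℝ :=
    ⟨monomialMatrix s q, monomialMatrix_mem _ _⟩ with hg
  have key : g * x = ⟨pauli (t + t') a' b', monomialMatrix_mem _ _⟩ * g := by
    apply Subtype.ext
    change monomialMatrix s q * x.1 = pauli (t + t') a' b' * monomialMatrix s q
    rw [hx, pauli, pauli, monomialMatrix_mul, monomialMatrix_mul]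
    congr 1
    · ext1 w
      exact ha' w
    · funext w
      have h := hb' w
      have h2 : q w + q w = 0 := CharTwo.add_self_eq_zero _
      simp only [Equiv.coe_addRight]
      linear_combination h - h2
  rw [key, mul_inv_cancel_right]

/-- The permutation of `𝔽₂^m` given by an invertible matrix. -/
def linearPerm {m : ℕ} (A B : Matrix (Fin m) (Fin m) (ZMod 2)) (hAB : A * B = 1) (hBA : B * A = 1) :
    Equiv.Perm (Fin m → ZMod 2) where
  toFun v := A *ᵥ v
  invFun v := B *ᵥ v
  left_inv v := by simp [hBA]
  right_inv v := by simp [hAB]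

theorem linearPerm_mem_cliffordGroup {m : ℕ} (hm : 1 ≤ m) (A B : Matrix (Fin m) (Fin m) (ZMod 2))
    (hAB : A * B = 1) (hBA : B * A = 1) :
    (⟨monomialMatrix (linearPerm A B hAB hBA) fun _ => 0, monomialMatrix_mem _ _⟩ :
      Matrix.orthogonalGroup (Fin m → ZMod 2) ℝ) ∈ cliffordGroup m := by
  refine monomialMatrix_mem_cliffordGroup hm _ _ (fun a => ⟨A *ᵥ a, fun w => ?_⟩)
    fun a b => ⟨0, b ᵥ* B, fun w => ?_⟩
  · simp [linearPerm, Matrix.mulVec_add]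
  · simp [linearPerm, ← Matrix.dotProduct_mulVec, hBA]

theorem quadratic_mem_cliffordGroup {m : ℕ} (hm : 1 ≤ m) (i j : Fin m) :
    (⟨monomialMatrix 1 fun w => w i * w j, monomialMatrix_mem _ _⟩ :
      Matrix.orthogonalGroup (Fin m → ZMod 2) ℝ) ∈ cliffordGroup m := by
  refine monomialMatrix_mem_cliffordGroup hm _ _ (fun a => ⟨a, fun w => rfl⟩)
    -- Polarization: (w + a)ᵢ(w + a)ⱼ - wᵢwⱼ = aᵢaⱼ + aⱼwᵢ + aᵢwⱼ.
    fun a b => ⟨a i * a j, b + Pi.single i (a j) + Pi.single j (a i), fun w => ?_⟩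
  have h2 : w i * w j + w i * w j = 0 := CharTwo.add_self_eq_zero _
  simp only [Pi.add_apply, add_dotProduct, single_dotProduct, Equiv.Perm.coe_one, id_eq]
  linear_combination h2

/-- The `2 × 2` Hadamard matrix. -/
noncomputable def hadamardOne : Matrix (ZMod 2) (ZMod 2) ℝ :=
  Matrix.of fun i j => (√2)⁻¹ * sign (i * j)

theorem sum_zmod_two {R : Type*} [AddCommMonoid R] (f : ZMod 2 → R) : ∑ i, f i = f 0 + f 1 :=
  Fin.sum_univ_two f

theorem hadamardOne_mem : hadamardOne ∈ Matrix.orthogonalGroup (ZMod 2) ℝ := by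
  rw [Matrix.mem_orthogonalGroup_iff]
  have h : (√2)⁻¹ * (√2)⁻¹ = (2⁻¹ : ℝ) := by
    rw [← mul_inv, Real.mul_self_sqrt (by norm_num)]
  ext i j
  rw [Matrix.mul_apply, sum_zmod_two]
  rcases zmod_two_cases i with rfl | rfl <;> rcases zmod_two_cases j with rfl | rfl <;>
    simp [hadamardOne, h] <;> norm_num

/-- The Hadamard matrix exchanges X and Z; restoring their order gives the sign of a b. -/
theorem hadamardOne_conj (t a b : ZMod 2) :
    hadamardOne * pauliOne t a b = pauliOne (t + a * b) b a * hadamardOne := by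
  ext i j
  rw [Matrix.mul_apply, Matrix.mul_apply, sum_zmod_two, sum_zmod_two]
  rcases zmod_two_cases i with rfl | rfl <;> rcases zmod_two_cases j with rfl | rfl <;>
    rcases zmod_two_cases t with rfl | rfl <;> rcases zmod_two_cases a with rfl | rfl <;>
    rcases zmod_two_cases b with rfl | rfl <;>
    simp [hadamardOne, pauliOne, monomialMatrix, CharTwo.add_self_eq_zero]

/-- The Hadamard transform in the coordinate `i`. -/
noncomputable def hadamard {m : ℕ} (i : Fin m) : Matrix.orthogonalGroup (Fin m → ZMod 2) ℝ :=
  tensorHom m (Pi.mulSingle i ⟨hadamardOne, hadamardOne_mem⟩)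

theorem hadamard_mem_cliffordGroup {m : ℕ} (hm : 1 ≤ m) (i : Fin m) :
    hadamard i ∈ cliffordGroup m := by
  refine mem_cliffordGroup_of_conj hm ?_
  rintro _ ⟨A, hA, rfl⟩
  rw [hadamard, ← map_mul, ← map_inv, ← map_mul]
  refine ⟨_, fun j _ => ?_, rfl⟩
  have hj := hA j (Set.mem_univ j)
  simp only [Pi.mul_apply, Pi.inv_apply]
  rcases eq_or_ne j i with rfl | hji
  · rw [Pi.mulSingle_eq_same]
    obtain ⟨t, a, b, h⟩ := mem_extraspecialOne_iff.mp hj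
    refine mem_extraspecialOne_iff.mpr ⟨t + a * b, b, a, ?_⟩
    have key : (⟨hadamardOne, hadamardOne_mem⟩ : Matrix.orthogonalGroup (ZMod 2) ℝ) * A j =
        ⟨pauliOne (t + a * b) b a, monomialMatrix_mem _ _⟩ * ⟨hadamardOne, hadamardOne_mem⟩ := by
      apply Subtype.ext
      change hadamardOne * (A j).1 = _
      rw [h, hadamardOne_conj]
      rfl
    rw [key, mul_inv_cancel_right]
  · rw [Pi.mulSingle_eq_of_ne hji]
    simpa using hj

theorem hadamard_apply {m : ℕ} (i : Fin m) (v w : Fin m → ZMod 2) :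
    (hadamard i).1 v w = (√2)⁻¹ * sign (v i * w i) * if ∀ j, j ≠ i → v j = w j then 1 else 0 := by
  change ∏ j, ((Pi.mulSingle i ⟨hadamardOne, hadamardOne_mem⟩ :
    Fin m → Matrix.orthogonalGroup (ZMod 2) ℝ) j).1 (v j) (w j) = _
  rw [← Finset.mul_prod_erase _ _ (Finset.mem_univ i)]
  congr 1
  · simp [hadamardOne]
  · rw [Finset.prod_congr rfl (g := fun j => if v j = w j then 1 else 0), Finset.prod_boole]
    · simp
    · intro j hj
      rw [Pi.mulSingle_eq_of_ne (Finset.ne_of_mem_erase hj)]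
      simp [Matrix.one_apply]

/-! ### Clifford-invariant tensors -/

theorem mem_dualCode {N : ℕ} {C : Submodule (ZMod 2) (Fin N → ZMod 2)} {x : Fin N → ZMod 2} :
    x ∈ dualCode C ↔ ∀ c ∈ C, c ⬝ᵥ x = 0 := Iff.rfl

theorem dotProduct_one_eq_self {N : ℕ} (c : Fin N → ZMod 2) : c ⬝ᵥ 1 = c ⬝ᵥ c := by
  refine Finset.sum_congr rfl fun n _ => ?_
  rcases zmod_two_cases (c n) with h | h <;> simp [h]

/-- Over 𝔽₂, c · 1 = c · c, which is 0 on a self-orthogonal code. -/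
theorem one_mem_of_dualCode_eq {N : ℕ} {C : Submodule (ZMod 2) (Fin N → ZMod 2)}
    (hC : dualCode C = C) : 1 ∈ C := by
  rw [← hC]
  intro c hc
  rw [dotProduct_one_eq_self]
  rw [← hC] at hc
  exact hc c (hC ▸ hc)

open Classical in
/-- The indicator function of the `N × m` matrices all of whose columns lie in `C`, seen as a
tensor in `⊗^N ℝ[𝔽₂^m]`. -/
noncomputable def codeTensor {N : ℕ} (m : ℕ) (C : Submodule (ZMod 2) (Fin N → ZMod 2)) :
    (Fin N → Fin m → ZMod 2) → ℝ :=
  fun M => if ∀ j, (fun n => M n j) ∈ C then 1 else 0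

/-- The action of a matrix on the factors of `⊗^N ℝ[ι]` that are selected by `c`. -/
noncomputable def localMatrix {N : ℕ} {ι : Type*} [DecidableEq ι] (c : Fin N → ZMod 2)
    (A : Matrix ι ι ℝ) : Matrix (Fin N → ι) (Fin N → ι) ℝ :=
  kron fun n => if c n = 0 then 1 else A

theorem kron_mul_localMatrix {N : ℕ} {ι : Type*} [Fintype ι] [DecidableEq ι] (c : Fin N → ZMod 2)
    {A B g : Matrix ι ι ℝ} (h : g * A = B * g) :
    (kron fun _ => g) * localMatrix c A = localMatrix c B * kron fun _ => g := by
  rw [localMatrix, localMatrix, kron_mul, kron_mul]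
  congr 1
  funext n
  by_cases hn : c n = 0 <;> simp [hn, h]

theorem localMatrix_pauli_mulVec {N m : ℕ} (c : Fin N → ZMod 2) (t : ZMod 2)
    (a b : Fin m → ZMod 2) (F : (Fin N → Fin m → ZMod 2) → ℝ) (M : Fin N → Fin m → ZMod 2) :
    (localMatrix c (pauli t a b) *ᵥ F) (fun n => M n + c n • a) =
      sign ((c ⬝ᵥ 1) * t + ∑ j, b j * (c ⬝ᵥ fun n => M n j)) * F M := by
  have h : localMatrix c (pauli t a b) = kron fun n =>
      monomialMatrix (Equiv.addRight (c n • a)) fun w => c n * (t + b ⬝ᵥ w) := by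
    rw [localMatrix]
    congr 1
    funext n
    rcases zmod_two_cases (c n) with hn | hn
    · simp only [hn, if_true, zero_smul, zero_mul]
      rw [← monomialMatrix_one]
      congr 1
      ext1 w
      simp
    · simp [hn, pauli]
  rw [h]
  refine (kron_monomialMatrix_mulVec _ _ F M).trans ?_
  congr 2
  simp only [mul_add, Finset.sum_add_distrib, dotProduct, Finset.sum_mul, Finset.mul_sum,
    Pi.one_apply, mul_one]
  rw [Finset.sum_comm]
  simp only [mul_left_comm]

/-- Tensors fixed by the stabilizer group of a self-dual code. -/
theorem eq_smul_codeTensor {N m : ℕ} {C : Submodule (ZMod 2) (Fin N → ZMod 2)}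
    (hC : dualCode C = C) {F : (Fin N → Fin m → ZMod 2) → ℝ}
    (hF : ∀ c ∈ C, ∀ a b : Fin m → ZMod 2, localMatrix c (pauli 0 a b) *ᵥ F = F) :
    F = F 0 • codeTensor m C := by
  have key : ∀ c ∈ C, ∀ (a b : Fin m → ZMod 2) M, F (fun n => M n + c n • a) =
      sign (∑ j, b j * (c ⬝ᵥ fun n => M n j)) * F M := by
    intro c hc a b M
    have := localMatrix_pauli_mulVec c 0 a b F M
    rwa [hF c hc, mul_zero, zero_add] at this
  funext M
  by_cases hM : ∀ j, (fun n => M n j) ∈ C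
  · have hs : ∀ s : Finset (Fin m), F (fun n j => if j ∈ s then M n j else 0) = F 0 := by
      intro s
      induction s using Finset.induction_on with
      | empty => rfl
      | insert i s hi ih =>
        rw [← ih]
        have := key _ (hM i) (Pi.single i 1) 0 fun n j => if j ∈ s then M n j else 0
        simp only [Pi.zero_apply, zero_mul, Finset.sum_const_zero, sign_zero, one_mul] at this
        rw [← this]
        congr 1
        funext n j
        by_cases hj : j = i
        · subst hj
          simp [hi]
        · simp [hj]
    have := hs Finset.univ
    simp only [Finset.mem_univ, if_true] at this
    simp [codeTensor, hM, this]
  · simp only [Pi.smul_apply, codeTensor, if_neg hM, smul_zero]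
    obtain ⟨j, hj⟩ := not_forall.mp hM
    rw [← hC, mem_dualCode] at hj
    push Not at hj
    obtain ⟨c, hc, hj⟩ := hj
    -- A Z-operator on a codeword not orthogonal to column j gives F(M) = -F(M).
    have := key c hc 0 (Pi.single j 1) M
    have h1 : (c ⬝ᵥ fun n => M n j) = 1 := (zmod_two_cases _).resolve_left hj
    simp [Pi.single_apply, h1] at this
    linarith

/-- The sign `t` is harmless because words of a self-dual code have even weight. This matters since
Clifford conjugation may introduce signs. -/
theorem localMatrix_pauli_mulVec_codeTensor {N m : ℕ} {C : Submodule (ZMod 2) (Fin N → ZMod 2)}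
    (hC : dualCode C = C) {c : Fin N → ZMod 2} (hc : c ∈ C) (t : ZMod 2) (a b : Fin m → ZMod 2) :
    localMatrix c (pauli t a b) *ᵥ codeTensor m C = codeTensor m C := by
  funext M'
  obtain ⟨M, rfl⟩ : ∃ M : Fin N → Fin m → ZMod 2, M' = fun n => M n + c n • a :=
    ⟨fun n => M' n + c n • a, by funext n j; simp [add_assoc, CharTwo.add_self_eq_zero]⟩
  have hd : ∀ d ∈ C, c ⬝ᵥ d = 0 := fun d hd => by
    rw [← hC] at hd
    exact hd c hc
  have hmem : ∀ j, (fun n => (M n + c n • a) j) ∈ C ↔ (fun n => M n j) ∈ C := by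
    intro j
    have : (fun n => (M n + c n • a) j) = (fun n => M n j) + a j • c := by
      funext n
      simp [mul_comm]
    rw [this]
    exact C.add_mem_iff_left (C.smul_mem _ hc)
  have hv : codeTensor m C (fun n => M n + c n • a) = codeTensor m C M := by
    classical
    exact if_congr (forall_congr' hmem) rfl rfl
  rw [localMatrix_pauli_mulVec, hv]
  by_cases hM : ∀ j, (fun n => M n j) ∈ C
  · simp [hd _ (hM _), hd _ (one_mem_of_dualCode_eq hC)]
  · simp [codeTensor, hM]

/-- The contraction of the first half of the tensor factors with the second half. -/
noncomputable def contraction {ι : Type*} [Fintype ι] {k : ℕ} (F : (Fin (2 * k) → ι) → ℝ) : ℝ :=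
  ∑ P : Fin k → ι, F (Sum.elim P P ∘ (finSumFinEquiv.trans (finCongr (two_mul k).symm)).symm)

/-- The contraction pairs the two halves by the standard bilinear form, which the orthogonal matrix
g ⊗ ⋯ ⊗ g (k factors) preserves. -/
theorem contraction_kron_mulVec {ι : Type*} [Fintype ι] [DecidableEq ι] {k : ℕ}
    (g : Matrix.orthogonalGroup ι ℝ) (F : (Fin (2 * k) → ι) → ℝ) :
    contraction ((kron fun _ => g.1) *ᵥ F) = contraction F := by
  classical
  set e := finSumFinEquiv.trans (finCongr (two_mul k).symm) with he
  set G : Matrix (Fin k → ι) (Fin k → ι) ℝ := kron fun _ => g.1 with hG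
  have hGG : Gᵀ * G = 1 := by
    have : Gᵀ = kron fun _ => g.1ᵀ := rfl
    rw [this, hG, kron_mul, ← kron_one]
    congr 1
    funext n
    exact (Matrix.mem_orthogonalGroup_iff' _ _).mp g.2
  have hsplit : ∀ P P' Q', (kron fun _ : Fin (2 * k) => g.1) (Sum.elim P P ∘ e.symm)
      (Sum.elim P' Q' ∘ e.symm) = G P P' * G P Q' := by
    intro P P' Q'
    rw [hG, kron_apply, kron_apply, kron_apply, ← Equiv.prod_comp e, Fintype.prod_sum_type]
    simp
  let E : (Fin k → ι) × (Fin k → ι) ≃ (Fin (2 * k) → ι) :=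
    (Equiv.sumArrowEquivProdArrow _ _ _).symm.trans (Equiv.arrowCongr e (Equiv.refl _))
  have hE : ∀ P Q, E (P, Q) = Sum.elim P Q ∘ e.symm := fun P Q => rfl
  simp only [contraction, ← he, Matrix.mulVec, dotProduct]
  simp_rw [← Equiv.sum_comp E, Fintype.sum_prod_type, hE, hsplit]
  rw [Finset.sum_comm]
  refine Finset.sum_congr rfl fun P' _ => ?_
  rw [Finset.sum_comm, Finset.sum_eq_single P']
  · rw [← Finset.sum_mul]
    have := congrFun (congrFun hGG P') P'
    rw [Matrix.mul_apply, Matrix.one_apply_eq] at this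
    simp only [Matrix.transpose_apply] at this
    rw [this, one_mul]
  · intro Q' _ hQ
    rw [← Finset.sum_mul]
    have := congrFun (congrFun hGG P') Q'
    rw [Matrix.mul_apply, Matrix.one_apply_ne hQ.symm] at this
    simp only [Matrix.transpose_apply] at this
    rw [this, zero_mul]
  · simp

theorem codeTensor_nonneg {N m : ℕ} (C : Submodule (ZMod 2) (Fin N → ZMod 2))
    (M : Fin N → Fin m → ZMod 2) : 0 ≤ codeTensor m C M := by
  rw [codeTensor]
  split_ifs <;> norm_num

theorem codeTensor_zero {N m : ℕ} (C : Submodule (ZMod 2) (Fin N → ZMod 2)) :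
    codeTensor m C 0 = 1 :=
  if_pos fun _ => C.zero_mem

theorem contraction_codeTensor_pos {k m : ℕ} (C : Submodule (ZMod 2) (Fin (2 * k) → ZMod 2)) :
    0 < contraction (codeTensor m C) := by
  refine Finset.sum_pos' (fun _ _ => codeTensor_nonneg _ _) ⟨0, Finset.mem_univ _, ?_⟩
  have : (Sum.elim (0 : Fin k → Fin m → ZMod 2) 0 ∘
      (finSumFinEquiv.trans (finCongr (two_mul k).symm)).symm) = 0 := by
    funext n
    simp only [Function.comp_apply]
    generalize (finSumFinEquiv.trans (finCongr (two_mul k).symm)).symm n = x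
    rcases x with x | x <;> rfl
  rw [this, codeTensor_zero]
  exact one_pos

/-- For a Pauli matrix x, g⁻¹xg is again a Pauli matrix up to sign, so the image of the code tensor
is fixed by the same stabilizer and is a multiple of the tensor. Comparing contractions gives the
factor 1. -/
theorem kron_mulVec_codeTensor {k m : ℕ} (hm : 1 ≤ m)
    {C : Submodule (ZMod 2) (Fin (2 * k) → ZMod 2)} (hC : dualCode C = C)
    {g : Matrix.orthogonalGroup (Fin m → ZMod 2) ℝ} (hg : g ∈ cliffordGroup m) :
    (kron fun _ => g.1) *ᵥ codeTensor m C = codeTensor m C := by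
  have h1 : (kron fun _ => g.1) *ᵥ codeTensor m C =
      ((kron fun _ => g.1) *ᵥ codeTensor m C) 0 • codeTensor m C := by
    refine eq_smul_codeTensor hC fun c hc a b => ?_
    have hx : (⟨pauli 0 a b, monomialMatrix_mem _ _⟩ :
        Matrix.orthogonalGroup (Fin m → ZMod 2) ℝ) ∈ extraspecial m :=
      (mem_extraspecial_iff hm).mpr ⟨_, _, _, rfl⟩
    set x : Matrix.orthogonalGroup (Fin m → ZMod 2) ℝ := ⟨pauli 0 a b, monomialMatrix_mem _ _⟩
    have hy : g⁻¹ * x * g⁻¹⁻¹ ∈ extraspecial m :=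
      (Subgroup.mem_normalizer_iff.mp (inv_mem hg) x).mp hx
    obtain ⟨t', a', b', hy'⟩ := (mem_extraspecial_iff hm).mp hy
    have hcomm : g * (g⁻¹ * x * g⁻¹⁻¹) = x * g := by group
    have hcomm' : g.1 * pauli t' a' b' = pauli 0 a b * g.1 := by
      rw [← hy']
      exact congrArg Subtype.val hcomm
    rw [Matrix.mulVec_mulVec, ← kron_mul_localMatrix c hcomm', ← Matrix.mulVec_mulVec,
      localMatrix_pauli_mulVec_codeTensor hC hc]
  set l := ((kron fun _ => g.1) *ᵥ codeTensor m C) 0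
  have h2 : contraction (l • codeTensor m C) = contraction (codeTensor m C) := by
    rw [← h1, contraction_kron_mulVec]
  have h3 : contraction (l • codeTensor m C) = l * contraction (codeTensor m C) := by
    simp [contraction, Finset.mul_sum]
  have h4 : l = 1 := by
    rw [h3] at h2
    exact mul_right_cancel₀ (contraction_codeTensor_pos C).ne' (h2.trans (one_mul _).symm)
  rw [h1, h4, one_smul]

/-! ### Linear maps with the same range -/

/-- The kernels have equal dimension by rank-nullity, and complements of both kernels are isomorphic
to the common range; the two isomorphisms are glued. -/
theorem exists_linearEquiv_comp_eq {K V W : Type*} [Field K] [AddCommGroup V] [Module K V]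
    [FiniteDimensional K V] [AddCommGroup W] [Module K W] {f f' : V →ₗ[K] W}
    (h : LinearMap.range f = LinearMap.range f') : ∃ e : V ≃ₗ[K] V, ∀ x, f (e x) = f' x := by
  obtain ⟨Q, hQ⟩ := (LinearMap.ker f).exists_isCompl
  obtain ⟨Q', hQ'⟩ := (LinearMap.ker f').exists_isCompl
  have hker : Module.finrank K (LinearMap.ker f') = Module.finrank K (LinearMap.ker f) := by
    have h1 := f.finrank_range_add_finrank_ker
    have h2 := f'.finrank_range_add_finrank_ker
    rw [h] at h1
    omega
  let p := LinearEquiv.ofFinrankEq _ _ hker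
  let q := f'.kerComplementEquivRange hQ'.symm
  let r := f.kerComplementEquivRange hQ.symm
  let s := (q.trans (LinearEquiv.ofEq _ _ h.symm)).trans r.symm
  refine ⟨(Submodule.prodEquivOfIsCompl _ _ hQ').symm.trans
    ((p.prodCongr s).trans (Submodule.prodEquivOfIsCompl _ _ hQ)), fun x => ?_⟩
  obtain ⟨⟨a, b⟩, rfl⟩ := (Submodule.prodEquivOfIsCompl _ _ hQ').surjective x
  have ha : f' a = 0 := a.2
  have hp : f (p a) = 0 := (p a).2
  have hs : f (s b) = f' b := by
    have h1 : ((r (s b) : LinearMap.range f) : W) = f (s b) := rfl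
    rw [← h1]
    simp [s, q]
  simp [ha, hp, hs]

/-- Applied to the maps K^m → Q defined by the two families, the previous lemma needs no linear
independence of either family. -/
theorem exists_matrix_of_span_eq {K Q : Type*} [Field K] [AddCommGroup Q] [Module K Q] {m : ℕ}
    {u u' : Fin m → Q}
    (h : Submodule.span K (Set.range u) = Submodule.span K (Set.range u')) :
    ∃ A B : Matrix (Fin m) (Fin m) K, A * B = 1 ∧ B * A = 1 ∧ ∀ i, u' i = ∑ j, A i j • u j := by
  obtain ⟨e, he⟩ := exists_linearEquiv_comp_eq (f := Fintype.linearCombination K u)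
    (f' := Fintype.linearCombination K u')
    (by rw [Fintype.range_linearCombination, Fintype.range_linearCombination, h])
  refine ⟨(LinearMap.toMatrix' e.toLinearMap)ᵀ, (LinearMap.toMatrix' e.symm.toLinearMap)ᵀ,
    ?_, ?_, fun i => ?_⟩
  · rw [← Matrix.transpose_mul, ← LinearMap.toMatrix'_comp]
    simp
  · rw [← Matrix.transpose_mul, ← LinearMap.toMatrix'_comp]
    simp
  · have := he (Pi.single i 1)
    simp only [Fintype.linearCombination_apply_single, one_smul] at this
    rw [← this, Fintype.linearCombination_apply]
    simp [LinearMap.toMatrix'_apply]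

/-! ### Invariance under the parabolic subgroup -/

/-- Invariance of a tensor under the real Clifford group. -/
def IsCliffordInvariant {N m : ℕ} (F : (Fin N → Fin m → ZMod 2) → ℝ) : Prop :=
  ∀ g ∈ cliffordGroup m, (kron fun _ => g.1) *ᵥ F = F

theorem IsCliffordInvariant.apply_mulVec {N m : ℕ} (hm : 1 ≤ m)
    {F : (Fin N → Fin m → ZMod 2) → ℝ} (hF : IsCliffordInvariant F)
    {A B : Matrix (Fin m) (Fin m) (ZMod 2)} (hAB : A * B = 1) (hBA : B * A = 1)
    (M : Fin N → Fin m → ZMod 2) : F (fun n => A *ᵥ M n) = F M := by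
  have h := kron_monomialMatrix_mulVec (fun _ : Fin N => linearPerm A B hAB hBA)
    (fun _ _ => 0) F M
  rw [hF _ (linearPerm_mem_cliffordGroup hm A B hAB hBA)] at h
  simpa [linearPerm] using h

theorem IsCliffordInvariant.apply_add {N m : ℕ} (hm : 1 ≤ m)
    {F : (Fin N → Fin m → ZMod 2) → ℝ} (hF : IsCliffordInvariant F) (a : Fin m → ZMod 2)
    (M : Fin N → Fin m → ZMod 2) : F (fun n => M n + a) = F M := by
  have h : ((kron fun _ : Fin N => pauli 0 a 0) *ᵥ F) (fun n => M n + a) = F M :=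
    (kron_monomialMatrix_mulVec (fun _ : Fin N => Equiv.addRight a) _ F M).trans (by simp)
  have h2 := hF _ (pauli_mem_cliffordGroup hm 0 a 0)
  rwa [h2] at h

/-- The phase wᵢwⱼ multiplies F(M) by the sign of the product of columns i and j. -/
theorem IsCliffordInvariant.dotProduct_eq_zero {N m : ℕ} (hm : 1 ≤ m)
    {F : (Fin N → Fin m → ZMod 2) → ℝ} (hF : IsCliffordInvariant F)
    {M : Fin N → Fin m → ZMod 2} (hM : F M ≠ 0) (i j : Fin m) :
    ((fun n => M n i) ⬝ᵥ fun n => M n j) = 0 := by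
  have h := kron_monomialMatrix_mulVec (fun _ : Fin N => (1 : Equiv.Perm (Fin m → ZMod 2)))
    (fun _ w => w i * w j) F M
  rw [hF _ (quadratic_mem_cliffordGroup hm i j)] at h
  have h1 : sign (∑ n, M n i * M n j) = sign 0 := by
    rw [sign_zero]
    exact mul_right_cancel₀ hM (h.symm.trans (one_mul _).symm)
  exact sign_injective h1

/-- The code generated by the columns of `M` and the all-ones vector. -/
def columnCode {N m : ℕ} (M : Fin N → Fin m → ZMod 2) : Submodule (ZMod 2) (Fin N → ZMod 2) :=
  Submodule.span (ZMod 2) (insert 1 (Set.range fun j n => M n j))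

theorem one_mem_columnCode {N m : ℕ} (M : Fin N → Fin m → ZMod 2) : 1 ∈ columnCode M :=
  Submodule.subset_span (Set.mem_insert _ _)

theorem columnCode_le_iff {N m : ℕ} {M : Fin N → Fin m → ZMod 2}
    {C : Submodule (ZMod 2) (Fin N → ZMod 2)} (h1 : 1 ∈ C) :
    columnCode M ≤ C ↔ ∀ j, (fun n => M n j) ∈ C := by
  rw [columnCode, Submodule.span_le, Set.insert_subset_iff, Set.range_subset_iff]
  exact and_iff_right h1

/-- Modulo the all-ones word the two column families have the same span, so an invertible matrix
relates them; the multiples of the all-ones word lost in the quotient form a translation. -/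
theorem IsCliffordInvariant.eq_of_columnCode_eq {N m : ℕ} (hm : 1 ≤ m)
    {F : (Fin N → Fin m → ZMod 2) → ℝ} (hF : IsCliffordInvariant F)
    {M M' : Fin N → Fin m → ZMod 2} (h : columnCode M = columnCode M') : F M = F M' := by
  set L := Submodule.span (ZMod 2) {(1 : Fin N → ZMod 2)} with hL
  have hmap : ∀ M : Fin N → Fin m → ZMod 2, (columnCode M).map L.mkQ =
      Submodule.span (ZMod 2) (Set.range fun j => L.mkQ fun n => M n j) := by
    intro M
    have h0 : L.mkQ 1 = 0 := by
      rw [Submodule.mkQ_apply, Submodule.Quotient.mk_eq_zero]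
      exact Submodule.mem_span_singleton_self _
    rw [columnCode, Submodule.map_span, Set.image_insert_eq, h0, Submodule.span_insert_zero,
      ← Set.range_comp]
    rfl
  obtain ⟨A, B, hAB, hBA, hA⟩ := exists_matrix_of_span_eq
    ((hmap M).symm.trans ((congrArg _ h).trans (hmap M')))
  have hA' : ∀ i, ∃ a : ZMod 2, ∀ n, M' n i = (A *ᵥ M n) i + a := by
    intro i
    have hi := hA i
    simp only [← map_smul, ← map_sum] at hi
    rw [Submodule.mkQ_apply, Submodule.mkQ_apply, Submodule.Quotient.eq, hL,
      Submodule.mem_span_singleton] at hi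
    obtain ⟨a, ha⟩ := hi
    refine ⟨a, fun n => ?_⟩
    have := congrFun ha n
    simp only [Pi.smul_apply, Pi.one_apply, smul_eq_mul, mul_one, Pi.sub_apply,
      Finset.sum_apply] at this
    rw [this]
    simp [Matrix.mulVec, dotProduct]
  choose a ha using hA'
  have hM' : M' = fun n => A *ᵥ M n + a := by
    funext n i
    exact ha i n
  rw [hM', hF.apply_add hm a fun n => A *ᵥ M n, hF.apply_mulVec hm hAB hBA]

/-- Self-orthogonal codes containing the all-ones vector. -/
def IsAdmissible {N : ℕ} (C : Submodule (ZMod 2) (Fin N → ZMod 2)) : Prop :=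
  1 ∈ C ∧ C ≤ dualCode C

theorem span_le_dualCode {N : ℕ} {S : Set (Fin N → ZMod 2)}
    (h : ∀ x ∈ S, ∀ y ∈ S, x ⬝ᵥ y = 0) :
    Submodule.span (ZMod 2) S ≤ dualCode (Submodule.span (ZMod 2) S) := by
  rw [Submodule.span_le]
  intro y hy c hc
  induction hc using Submodule.span_induction with
  | mem x hx => exact h x hx y hy
  | zero => exact zero_dotProduct y
  | add x z _ _ hx hz => rw [add_dotProduct, hx, hz, add_zero]
  | smul a x _ hx => rw [smul_dotProduct, hx, smul_zero]

theorem IsCliffordInvariant.isAdmissible_columnCode {k m : ℕ} (hm : 1 ≤ m)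
    {F : (Fin (2 * k) → Fin m → ZMod 2) → ℝ} (hF : IsCliffordInvariant F)
    {M : Fin (2 * k) → Fin m → ZMod 2} (hM : F M ≠ 0) : IsAdmissible (columnCode M) := by
  refine ⟨one_mem_columnCode M, span_le_dualCode ?_⟩
  -- The length 2k is even.
  have h11 : (1 : Fin (2 * k) → ZMod 2) ⬝ᵥ 1 = 0 := by
    have : (2 : ZMod 2) = 0 := by decide
    simp [this]
  have h := hF.dotProduct_eq_zero hm hM
  rintro x (rfl | ⟨i, rfl⟩) y (rfl | ⟨j, rfl⟩)
  · exact h11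
  · rw [dotProduct_comm, dotProduct_one_eq_self]
    exact h j j
  · rw [dotProduct_one_eq_self]
    exact h i i
  · exact h i j

open Classical in
-- Möbius inversion: a code tensor is the sum of these indicators over the subcodes containing the
-- all-ones word, and such subcodes of an admissible code are admissible.
theorem indicator_columnCode_mem_span {N : ℕ} (m : ℕ) {C : Submodule (ZMod 2) (Fin N → ZMod 2)}
    (hC : IsAdmissible C) :
    (fun M : Fin N → Fin m → ZMod 2 => if columnCode M = C then (1 : ℝ) else 0) ∈
      Submodule.span ℝ (codeTensor m '' {D : Submodule (ZMod 2) (Fin N → ZMod 2) |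
        IsAdmissible D}) := by
  have : Fintype (Submodule (ZMod 2) (Fin N → ZMod 2)) := Fintype.ofFinite _
  induction C using WellFoundedLT.induction with
  | ind C ih =>
  have hsum : (fun M : Fin N → Fin m → ZMod 2 => if columnCode M = C then (1 : ℝ) else 0) =
      codeTensor m C - ∑ D : Submodule (ZMod 2) (Fin N → ZMod 2) with 1 ∈ D ∧ D < C,
        fun M => if columnCode M = D then (1 : ℝ) else 0 := by
    funext M
    simp only [Pi.sub_apply, Finset.sum_apply, Finset.sum_ite_eq, Finset.mem_filter,
      Finset.mem_univ, true_and, one_mem_columnCode]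
    have h1 : codeTensor m C M = if columnCode M ≤ C then 1 else 0 :=
      if_congr (columnCode_le_iff hC.1).symm rfl rfl
    rw [h1]
    rcases eq_or_ne (columnCode M) C with h | h
    · simp [h]
    · have h2 : columnCode M < C ↔ columnCode M ≤ C := ⟨le_of_lt, fun h2 => lt_of_le_of_ne h2 h⟩
      simp [h, h2]
  rw [hsum]
  refine Submodule.sub_mem _ (Submodule.subset_span ⟨C, hC, rfl⟩) (Submodule.sum_mem _ ?_)
  intro D hD
  rw [Finset.mem_filter] at hD
  exact ih D hD.2.2 ⟨hD.2.1, fun x hx c hc => hC.2 (hD.2.2.le hx) c (hD.2.2.le hc)⟩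

theorem IsCliffordInvariant.mem_span_isAdmissible {k m : ℕ} (hm : 1 ≤ m)
    {F : (Fin (2 * k) → Fin m → ZMod 2) → ℝ} (hF : IsCliffordInvariant F) :
    F ∈ Submodule.span ℝ (codeTensor m '' {D : Submodule (ZMod 2) (Fin (2 * k) → ZMod 2) |
      IsAdmissible D}) := by
  classical
  have : Fintype (Submodule (ZMod 2) (Fin (2 * k) → ZMod 2)) := Fintype.ofFinite _
  -- The common value of `F` on matrices with column code `D`; 0 if there is none.
  let φ : Submodule (ZMod 2) (Fin (2 * k) → ZMod 2) → ℝ := fun D =>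
    if h : ∃ M : Fin (2 * k) → Fin m → ZMod 2, columnCode M = D then F h.choose else 0
  have hφ : ∀ M, φ (columnCode M) = F M := by
    intro M
    have h : ∃ M' : Fin (2 * k) → Fin m → ZMod 2, columnCode M' = columnCode M := ⟨M, rfl⟩
    simp only [φ, dif_pos h]
    exact hF.eq_of_columnCode_eq hm h.choose_spec
  have hsum : F = ∑ D : Submodule (ZMod 2) (Fin (2 * k) → ZMod 2),
      φ D • fun M => if columnCode M = D then (1 : ℝ) else 0 := by
    funext M
    simp [hφ]
  rw [hsum]
  refine Submodule.sum_mem _ fun D _ => ?_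
  by_cases h : φ D = 0
  · simp [h]
  · refine Submodule.smul_mem _ _ (indicator_columnCode_mem_span m ?_)
    have hD : ∃ M : Fin (2 * k) → Fin m → ZMod 2, columnCode M = D := by
      by_contra hD
      exact h (dif_neg hD)
    obtain ⟨M, rfl⟩ := hD
    rw [hφ] at h
    exact hF.isAdmissible_columnCode hm h

/-! ### Character sums over codes -/

open Classical in
theorem sum_mem_code {N : ℕ} (C : Submodule (ZMod 2) (Fin N → ZMod 2)) :
    (∑ u : Fin N → ZMod 2, if u ∈ C then (1 : ℝ) else 0) = Nat.card C := by
  rw [Finset.sum_boole, Nat.card_eq_fintype_card, Fintype.card_subtype]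

open Classical in
theorem sum_mem_code_sign {N : ℕ} (C : Submodule (ZMod 2) (Fin N → ZMod 2))
    (x : Fin N → ZMod 2) :
    (∑ u : Fin N → ZMod 2, if u ∈ C then sign (u ⬝ᵥ x) else 0) =
      if x ∈ dualCode C then (Nat.card C : ℝ) else 0 := by
  split_ifs with hx
  · rw [← sum_mem_code]
    refine Finset.sum_congr rfl fun u _ => ?_
    by_cases hu : u ∈ C
    · simp [hu, hx u hu]
    · simp [hu]
  · rw [mem_dualCode] at hx
    push Not at hx
    obtain ⟨c, hc, hcx⟩ := hx
    have h1 : c ⬝ᵥ x = 1 := (zmod_two_cases _).resolve_left hcx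
    -- Translation by c permutes the code and flips every sign, so the sum is its own negative.
    have h2 : (∑ u : Fin N → ZMod 2, if u ∈ C then sign (u ⬝ᵥ x) else 0) =
        -∑ u : Fin N → ZMod 2, if u ∈ C then sign (u ⬝ᵥ x) else 0 := by
      conv_lhs => rw [← Equiv.sum_comp (Equiv.addRight c)]
      rw [← Finset.sum_neg_distrib]
      refine Finset.sum_congr rfl fun u _ => ?_
      simp only [Equiv.coe_addRight, C.add_mem_iff_left hc, add_dotProduct, h1, sign_add,
        sign_one, mul_neg, mul_one]
      split_ifs <;> simp
    linarith

/-- The sum of (-1)^(u · x) over u in C and all x is computed in both orders. -/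
theorem card_mul_card_dualCode {N : ℕ} (C : Submodule (ZMod 2) (Fin N → ZMod 2)) :
    Nat.card C * Nat.card (dualCode C) = 2 ^ N := by
  classical
  have h1 : ∑ x : Fin N → ZMod 2, (∑ u : Fin N → ZMod 2, if u ∈ C then sign (u ⬝ᵥ x) else 0) =
      Nat.card C * Nat.card (dualCode C) := by
    simp_rw [sum_mem_code_sign]
    rw [← sum_mem_code (dualCode C), Finset.mul_sum]
    simp
  have h2 : ∀ u : Fin N → ZMod 2, ∑ x : Fin N → ZMod 2, sign (u ⬝ᵥ x) =
      if u = 0 then 2 ^ N else 0 := by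
    intro u
    have := sum_mem_code_sign (⊤ : Submodule (ZMod 2) (Fin N → ZMod 2)) u
    simp only [Submodule.mem_top, if_true] at this
    simp_rw [dotProduct_comm u]
    rw [this]
    have hu : u ∈ dualCode (⊤ : Submodule (ZMod 2) (Fin N → ZMod 2)) ↔ u = 0 := by
      refine ⟨fun h => ?_, fun h => h ▸ Submodule.zero_mem _⟩
      funext n
      simpa using h (Pi.single n 1) trivial
    simp [hu]
  rw [Finset.sum_comm] at h1
  have h3 : ∀ u : Fin N → ZMod 2,
      (∑ x : Fin N → ZMod 2, if u ∈ C then sign (u ⬝ᵥ x) else 0) = if u = 0 then 2 ^ N else 0 := by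
    intro u
    by_cases hu : u ∈ C
    · simp only [hu, if_true, h2]
    · have : u ≠ 0 := fun h => hu (h ▸ C.zero_mem)
      simp [hu, this]
  simp_rw [h3] at h1
  simp only [Finset.sum_ite_eq', Finset.mem_univ, if_true] at h1
  exact_mod_cast h1.symm

/-! ### The averaged Hadamard transform -/

/-- Poisson summation in column i: the condition of lying in C turns into lying in the dual code,
with factor |C| and normalization (√2)^(-2k) = 2^(-k). -/
theorem hadamard_mulVec_codeTensor {k m : ℕ} (i : Fin m)
    (C : Submodule (ZMod 2) (Fin (2 * k) → ZMod 2)) (M : Fin (2 * k) → Fin m → ZMod 2)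
    [Decidable ((fun n => M n i) ∈ dualCode C ∧ ∀ j, j ≠ i → (fun n => M n j) ∈ C)] :
    ((kron fun _ => (hadamard i).1) *ᵥ codeTensor m C) M =
      (2 ^ k)⁻¹ * if (fun n => M n i) ∈ dualCode C ∧ ∀ j, j ≠ i → (fun n => M n j) ∈ C
        then (Nat.card C : ℝ) else 0 := by
  classical
  have hk : ((√2)⁻¹ : ℝ) ^ (2 * k) = (2 ^ k)⁻¹ := by
    rw [pow_mul, inv_pow, Real.sq_sqrt (by norm_num), inv_pow]
  have hentry : ∀ M', (kron fun _ : Fin (2 * k) => (hadamard i).1) M M' =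
      (2 ^ k)⁻¹ * sign ((fun n => M' n i) ⬝ᵥ fun n => M n i) *
        if ∀ n j, j ≠ i → M n j = M' n j then 1 else 0 := by
    intro M'
    simp only [kron_apply, hadamard_apply, Finset.prod_mul_distrib, Finset.prod_const,
      Finset.card_univ, Fintype.card_fin, hk, Finset.prod_boole, Finset.mem_univ, true_imp_iff]
    rw [dotProduct, sign_sum]
    simp only [mul_comm]
  -- Only matrices agreeing with `M` outside column i contribute; they are indexed by that column.
  rw [Matrix.mulVec, dotProduct, ← Fintype.sum_of_injective
    (fun (u : Fin (2 * k) → ZMod 2) n => Function.update (M n) i (u n)) ?_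
    (fun u => (2 ^ k)⁻¹ * ((if u ∈ C then sign (u ⬝ᵥ fun n => M n i) else 0) *
      if ∀ j, j ≠ i → (fun n => M n j) ∈ C then 1 else 0)) _ ?_ ?_]
  · rw [← Finset.mul_sum, ← Finset.sum_mul, sum_mem_code_sign]
    congr 1
    by_cases h1 : (fun n => M n i) ∈ dualCode C <;>
      by_cases h2 : ∀ j, j ≠ i → (fun n => M n j) ∈ C
    · rw [if_pos h1, if_pos h2, if_pos ⟨h1, h2⟩, mul_one]
    · rw [if_neg h2, mul_zero]
      exact (if_neg fun h => h2 h.2).symm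
    · rw [if_neg h1, zero_mul]
      exact (if_neg fun h => h1 h.1).symm
    · rw [if_neg h2, mul_zero]
      exact (if_neg fun h => h2 h.2).symm
  · intro u u' h
    funext n
    have := congrFun (congrFun h n) i
    simpa using this
  · intro M' hM'
    rw [hentry, if_neg, mul_zero, zero_mul]
    intro h
    refine hM' ⟨fun n => M' n i, ?_⟩
    funext n j
    by_cases hj : j = i
    · subst hj
      simp
    · simp [hj, h n j hj]
  · intro u
    have h1 : ∀ n j, j ≠ i → M n j = Function.update (M n) i (u n) j := fun n j hj => by simp [hj]
    have h2 : codeTensor m C (fun n => Function.update (M n) i (u n)) =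
        (if u ∈ C then 1 else 0) * if ∀ j, j ≠ i → (fun n => M n j) ∈ C then 1 else 0 := by
      rw [ite_zero_mul_ite_zero, mul_one]
      refine if_congr ⟨fun h => ⟨by simpa using h i, fun j hj => by simpa [hj] using h j⟩,
        fun h j => ?_⟩ rfl rfl
      by_cases hj : j = i
      · subst hj
        simpa using h.1
      · simpa [hj] using h.2 j hj
    rw [hentry, if_pos h1, h2]
    simp only [Function.update_self]
    by_cases hu : u ∈ C <;> simp [hu]

open Classical in
/-- A conjugate of the Hadamard transform, in the direction `l`. -/
theorem exists_directional_hadamard {k m : ℕ} (hm : 1 ≤ m) {l : Fin m → ZMod 2} (hl : l ≠ 0) :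
    ∃ T : ((Fin (2 * k) → Fin m → ZMod 2) → ℝ) →ₗ[ℝ] ((Fin (2 * k) → Fin m → ZMod 2) → ℝ),
      (∀ F, IsCliffordInvariant F → T F = F) ∧
      ∀ C, IsAdmissible C → ∀ M, T (codeTensor m C) M = (2 ^ k)⁻¹ *
        ∑ v : Fin (2 * k) → ZMod 2, if v ∈ dualCode C then
          (if ∀ j, (fun n => M n j) + l j • v ∈ C then 1 else 0) else 0 := by
  let i : Fin m := ⟨0, hm⟩
  obtain ⟨j₀, hj₀⟩ := Function.ne_iff.mp hl
  have hspan : ∀ u : Fin m → ZMod 2, (∃ j, u j = 1) →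
      Submodule.span (ZMod 2) (Set.range u) = ⊤ := by
    rintro u ⟨j, hj⟩
    rw [eq_top_iff]
    intro x _
    have : (1 : ZMod 2) ∈ Submodule.span (ZMod 2) (Set.range u) :=
      Submodule.subset_span ⟨j, hj⟩
    simpa using Submodule.smul_mem _ x this
  -- The entries of `l` and of the unit vector both span the line 𝔽₂, which yields an invertible `A`
  -- taking `l` to the unit vector.
  obtain ⟨A, B, hAB, hBA, hA⟩ := exists_matrix_of_span_eq (K := ZMod 2) (u := l)
    (u' := Pi.single i 1) ((hspan l ⟨j₀, (zmod_two_cases _).resolve_left hj₀⟩).trans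
      (hspan _ ⟨i, Pi.single_eq_same _ _⟩).symm)
  have hAl : A *ᵥ l = Pi.single i 1 := by
    funext r
    rw [hA r]
    simp [Matrix.mulVec, dotProduct]
  refine ⟨(LinearMap.funLeft ℝ ℝ fun M n => A *ᵥ M n).comp
    (Matrix.mulVecLin (kron fun _ => (hadamard i).1)), fun F hF => ?_, fun C hC M => ?_⟩
  · funext M
    simp only [LinearMap.comp_apply, LinearMap.funLeft_apply, Matrix.mulVecLin_apply]
    rw [hF _ (hadamard_mem_cliffordGroup hm i), hF.apply_mulVec hm hAB hBA]
  · simp only [LinearMap.comp_apply, LinearMap.funLeft_apply, Matrix.mulVecLin_apply]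
    rw [hadamard_mulVec_codeTensor]
    congr 1
    have hcol : ∀ (D : Matrix (Fin m) (Fin m) (ZMod 2)) (P : Fin (2 * k) → Fin m → ZMod 2),
        (∀ j, (fun n => P n j) ∈ C) → ∀ r, (fun n => (D *ᵥ P n) r) ∈ C := by
      intro D P hP r
      have : (fun n => (D *ᵥ P n) r) = ∑ j, D r j • fun n => P n j := by
        funext n
        simp [Matrix.mulVec, dotProduct]
      rw [this]
      exact Submodule.sum_mem _ fun j _ => Submodule.smul_mem _ _ (hP j)
    have hiff : ∀ v : Fin (2 * k) → ZMod 2, (∀ j, (fun n => M n j) + l j • v ∈ C) ↔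
        (fun n => (A *ᵥ M n) i) + v ∈ C ∧ ∀ r, r ≠ i → (fun n => (A *ᵥ M n) r) ∈ C := by
      intro v
      have h1 : ∀ n, A *ᵥ (M n + v n • l) = A *ᵥ M n + v n • Pi.single i 1 := fun n => by
        rw [Matrix.mulVec_add, Matrix.mulVec_smul, hAl]
      have e1 : (∀ j, (fun n => M n j) + l j • v ∈ C) ↔
          ∀ j, (fun n => (M n + v n • l) j) ∈ C := by
        refine forall_congr' fun j => ?_
        have : (fun n => M n j) + l j • v = fun n => (M n + v n • l) j := by
          funext n
          simp [mul_comm]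
        rw [this]
      have e2 : (∀ j, (fun n => (M n + v n • l) j) ∈ C) ↔
          ∀ r, (fun n => (A *ᵥ (M n + v n • l)) r) ∈ C := by
        refine ⟨fun h => hcol A _ h, fun h => ?_⟩
        have := hcol B _ h
        simpa [hBA] using this
      rw [e1, e2]
      simp only [h1]
      constructor
      · intro h
        refine ⟨?_, fun r hr => ?_⟩
        · have := h i
          simp only [Pi.add_apply, Pi.smul_apply, Pi.single_eq_same, smul_eq_mul, mul_one] at this
          exact this
        · simpa [hr] using h r
      · rintro ⟨h, h'⟩ r
        by_cases hr : r = i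
        · subst hr
          simp only [Pi.add_apply, Pi.smul_apply, Pi.single_eq_same, smul_eq_mul, mul_one]
          exact h
        · simpa [hr] using h' r hr
    simp only [hiff]
    set x : Fin (2 * k) → ZMod 2 := fun n => (A *ᵥ M n) i
    -- After shifting v by x, the conditions read v ∈ C and x in the dual code, so the sum counts
    -- |C|.
    rw [← Equiv.sum_comp (Equiv.addLeft x)]
    have hxx : x + x = 0 := by
      funext n
      exact CharTwo.add_self_eq_zero _
    by_cases h2 : ∀ r, r ≠ i → (fun n => (A *ᵥ M n) r) ∈ C
    · have h3 : ∀ v, (if x + v ∈ dualCode C then (if x + (x + v) ∈ C ∧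
          ∀ r, r ≠ i → (fun n => (A *ᵥ M n) r) ∈ C then (1 : ℝ) else 0) else 0) =
          (if v ∈ C then 1 else 0) * if x ∈ dualCode C then 1 else 0 := by
        intro v
        rw [← add_assoc, hxx, zero_add]
        by_cases hv : v ∈ C
        · simp only [(dualCode C).add_mem_iff_left (hC.2 hv), hv, true_and, if_pos h2, if_true,
            one_mul]
        · simp [hv]
      refine Eq.trans ?_ (Finset.sum_congr rfl fun v _ => h3 v).symm
      rw [← Finset.sum_mul, sum_mem_code, mul_ite, mul_one, mul_zero]
      exact if_congr (and_iff_left h2) rfl rfl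
    · refine (if_neg fun h => h2 h.2).trans (Eq.symm (Finset.sum_eq_zero fun v _ => ?_))
      split_ifs with h3 h4
      · exact absurd h4.2 h2
      · rfl
      · rfl

/-- The eigenvalue of the averaged Hadamard transform on codes with `c` elements. -/
noncomputable def averageEigenvalue (k m c : ℕ) : ℝ :=
  ((2 ^ m - 1) * 2 ^ k)⁻¹ * (c * (2 ^ m - 1) - ((2 ^ (2 * k) : ℝ) / c - c))

/-- The first term is below 2^k(2^m - 1), and the subtracted one, |C^⊥| - |C|, is nonnegative. -/
theorem averageEigenvalue_lt_one {k m c : ℕ} (hm : 1 ≤ m) (hc : 1 ≤ c) (hck : c < 2 ^ k) :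
    averageEigenvalue k m c < 1 := by
  have h2m : (0 : ℝ) < 2 ^ m - 1 := by
    rw [sub_pos]
    exact one_lt_pow₀ (by norm_num) (by omega)
  have hc0 : (0 : ℝ) < c := by exact_mod_cast hc
  have hck' : (c : ℝ) < 2 ^ k := by exact_mod_cast hck
  have h1 : (c : ℝ) ≤ (2 ^ (2 * k) : ℝ) / c := by
    rw [le_div_iff₀ hc0, mul_comm 2 k, pow_mul, sq]
    exact mul_le_mul hck'.le hck'.le hc0.le (by positivity)
  rw [averageEigenvalue, inv_mul_lt_iff₀ (by positivity)]
  nlinarith [mul_lt_mul_of_pos_right hck' h2m]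

theorem mem_sup_span_singleton_iff {N : ℕ} {C : Submodule (ZMod 2) (Fin N → ZMod 2)}
    {v x : Fin N → ZMod 2} : x ∈ C ⊔ Submodule.span (ZMod 2) {v} ↔ x ∈ C ∨ x + v ∈ C := by
  have hvv : v + v = 0 := by
    funext n
    exact CharTwo.add_self_eq_zero _
  rw [Submodule.mem_sup]
  constructor
  · rintro ⟨y, hy, z, hz, rfl⟩
    obtain ⟨a, rfl⟩ := Submodule.mem_span_singleton.mp hz
    rcases zmod_two_cases a with rfl | rfl
    · left
      simpa using hy
    · right
      rw [one_smul, add_assoc, hvv, add_zero]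
      exact hy
  · rintro (h | h)
    · exact ⟨x, h, 0, Submodule.zero_mem _, add_zero x⟩
    · exact ⟨x + v, h, v, Submodule.mem_span_singleton_self v, by rw [add_assoc, hvv, add_zero]⟩

/-- The new generator is self-orthogonal because v · v = v · 1 and the all-ones word lies in C. -/
theorem isAdmissible_sup_span {N : ℕ} {C : Submodule (ZMod 2) (Fin N → ZMod 2)}
    (hC : IsAdmissible C) {v : Fin N → ZMod 2} (hv : v ∈ dualCode C) :
    IsAdmissible (C ⊔ Submodule.span (ZMod 2) {v}) := by
  refine ⟨Submodule.mem_sup_left hC.1, ?_⟩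
  have h : C ⊔ Submodule.span (ZMod 2) {v} = Submodule.span (ZMod 2) (C ∪ {v}) := by
    rw [Submodule.span_union, Submodule.span_eq]
  rw [h]
  refine span_le_dualCode ?_
  have hvv : v ⬝ᵥ v = 0 := by
    rw [← dotProduct_one_eq_self, dotProduct_comm]
    exact hv 1 hC.1
  rintro x (hx | rfl) y (hy | rfl)
  · exact hC.2 hy x hx
  · exact hv x hx
  · rw [dotProduct_comm]
    exact hv y hy
  · exact hvv

theorem card_lt_card_sup_span {N : ℕ} {C : Submodule (ZMod 2) (Fin N → ZMod 2)}
    {v : Fin N → ZMod 2} (hv : v ∉ C) :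
    Nat.card C < Nat.card (C ⊔ Submodule.span (ZMod 2) {v} : Submodule _ _) := by
  refine Set.Finite.card_lt_card (Set.toFinite _) ?_
  refine (Set.ssubset_iff_of_subset fun x hx => Submodule.mem_sup_left hx).mpr
    ⟨v, Submodule.mem_sup_right (Submodule.mem_span_singleton_self v), hv⟩

open Classical in
-- If v ∈ C, all 2^m directions contribute equally. Otherwise the sum factors over the columns, and
-- each column admits at most one coefficient of v, exactly one when it lies in C + ⟨v⟩.
theorem sum_directions {N m : ℕ} (C : Submodule (ZMod 2) (Fin N → ZMod 2)) (v : Fin N → ZMod 2)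
    (M : Fin N → Fin m → ZMod 2) :
    (∑ l : Fin m → ZMod 2, if ∀ j, (fun n => M n j) + l j • v ∈ C then (1 : ℝ) else 0) =
      if v ∈ C then 2 ^ m * codeTensor m C M
        else codeTensor m (C ⊔ Submodule.span (ZMod 2) {v}) M := by
  split_ifs with hv
  · have h : ∀ l : Fin m → ZMod 2, (∀ j, (fun n => M n j) + l j • v ∈ C) ↔
        ∀ j, (fun n => M n j) ∈ C := fun l =>
      forall_congr' fun j => C.add_mem_iff_left (C.smul_mem _ hv)
    simp [h, codeTensor]
  · have h : ∀ x : Fin N → ZMod 2, (∑ a : ZMod 2, if x + a • v ∈ C then (1 : ℝ) else 0) =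
        if x ∈ C ⊔ Submodule.span (ZMod 2) {v} then 1 else 0 := by
      intro x
      rw [sum_zmod_two, zero_smul, add_zero, one_smul]
      simp only [mem_sup_span_singleton_iff]
      by_cases h1 : x ∈ C
      · have h2 : x + v ∉ C := fun h2 => hv ((C.add_mem_iff_right h1).mp h2)
        simp [h1, h2]
      · simp [h1]
    have h2 := Finset.prod_univ_sum (fun _ : Fin m => (Finset.univ : Finset (ZMod 2)))
      fun j a => if (fun n => M n j) + a • v ∈ C then (1 : ℝ) else 0
    simp only [h, Fintype.piFinset_univ, Finset.prod_boole, Finset.mem_univ, true_imp_iff] at h2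
    exact h2.symm

open Classical in
theorem sum_nonzero_directions {N m : ℕ} (C : Submodule (ZMod 2) (Fin N → ZMod 2))
    (v : Fin N → ZMod 2) (M : Fin N → Fin m → ZMod 2) :
    (∑ l : Fin m → ZMod 2 with l ≠ 0,
      if ∀ j, (fun n => M n j) + l j • v ∈ C then (1 : ℝ) else 0) =
      (if v ∈ C then 2 ^ m * codeTensor m C M
        else codeTensor m (C ⊔ Submodule.span (ZMod 2) {v}) M) - codeTensor m C M := by
  rw [← sum_directions, eq_sub_iff_add_eq, Finset.filter_ne',
    ← Finset.sum_erase_add _ _ (Finset.mem_univ (0 : Fin m → ZMod 2))]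
  congr 1
  simp [codeTensor]

open Classical in
/-- The averaged Hadamard transform fixes invariant tensors and is triangular on code tensors. -/
theorem exists_averaged_hadamard (k : ℕ) {m : ℕ} (hm : 1 ≤ m) :
    ∃ T : ((Fin (2 * k) → Fin m → ZMod 2) → ℝ) →ₗ[ℝ] ((Fin (2 * k) → Fin m → ZMod 2) → ℝ),
      (∀ F, IsCliffordInvariant F → T F = F) ∧
      ∀ C, IsAdmissible C → T (codeTensor m C) =
        averageEigenvalue k m (Nat.card C) • codeTensor m C + ((2 ^ m - 1) * 2 ^ k : ℝ)⁻¹ •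
          ∑ v : Fin (2 * k) → ZMod 2 with v ∈ dualCode C ∧ v ∉ C,
            codeTensor m (C ⊔ Submodule.span (ZMod 2) {v}) := by
  have h2m : (2 ^ m - 1 : ℝ) ≠ 0 := by
    rw [sub_ne_zero]
    exact (one_lt_pow₀ (by norm_num) (by omega)).ne'
  have hex : ∀ l : Fin m → ZMod 2, ∃ T : ((Fin (2 * k) → Fin m → ZMod 2) → ℝ) →ₗ[ℝ]
      ((Fin (2 * k) → Fin m → ZMod 2) → ℝ), l ≠ 0 → _ := fun l => by
    by_cases hl : l = 0
    -- A dummy value: direction 0 is left out of the average.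
    · exact ⟨0, fun h => absurd hl h⟩
    · obtain ⟨T, hT⟩ := exists_directional_hadamard (k := k) hm hl
      exact ⟨T, fun _ => hT⟩
  choose T hT using hex
  refine ⟨(2 ^ m - 1 : ℝ)⁻¹ • ∑ l : Fin m → ZMod 2 with l ≠ 0, T l, fun F hF => ?_,
    fun C hC => ?_⟩
  · rw [LinearMap.smul_apply, LinearMap.sum_apply,
      Finset.sum_congr rfl fun l hl => (hT l (Finset.mem_filter.mp hl).2).1 F hF,
      Finset.sum_const, ← Nat.cast_smul_eq_nsmul ℝ, smul_smul]
    have hcard : (((Finset.univ.filter fun l : Fin m → ZMod 2 => l ≠ 0).card : ℕ) : ℝ) =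
        2 ^ m - 1 := by
      rw [Finset.filter_ne', Finset.card_erase_of_mem (Finset.mem_univ _), Finset.card_univ,
        Nat.cast_sub Fintype.card_pos]
      simp
    rw [hcard, inv_mul_cancel₀ h2m, one_smul]
  · funext M
    have hcard : (Nat.card (dualCode C) : ℝ) = 2 ^ (2 * k) / Nat.card C := by
      rw [eq_div_iff (by exact_mod_cast Nat.card_pos.ne'), mul_comm]
      exact_mod_cast card_mul_card_dualCode C
    have hsplit : ∀ v : Fin (2 * k) → ZMod 2, (if v ∈ dualCode C then
        ((if v ∈ C then 2 ^ m * codeTensor m C M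
          else codeTensor m (C ⊔ Submodule.span (ZMod 2) {v}) M) - codeTensor m C M) else 0) =
        (if v ∈ C then 1 else 0) * (2 ^ m * codeTensor m C M) +
        (if v ∈ dualCode C ∧ v ∉ C then codeTensor m (C ⊔ Submodule.span (ZMod 2) {v}) M else 0) -
        (if v ∈ dualCode C then 1 else 0) * codeTensor m C M := by
      intro v
      by_cases h1 : v ∈ C
      · simp [h1, hC.2 h1]
      · simp only [h1, if_false, not_false_eq_true, and_true]
        split_ifs <;> ring
    -- Words v ∈ C contribute |C| 2^m, words outside C the enlarged codes, and omitting l = 0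
    -- subtracts |C^⊥| = 2^(2k)/|C|.
    have hsum : ∑ l : Fin m → ZMod 2 with l ≠ 0, T l (codeTensor m C) M =
        (2 ^ k)⁻¹ * (Nat.card C * (2 ^ m * codeTensor m C M) +
        (∑ v : Fin (2 * k) → ZMod 2 with v ∈ dualCode C ∧ v ∉ C,
            codeTensor m (C ⊔ Submodule.span (ZMod 2) {v}) M) -
          2 ^ (2 * k) / Nat.card C * codeTensor m C M) := by
      rw [Finset.sum_congr rfl fun l hl => (hT l (Finset.mem_filter.mp hl).2).2 C hC M,
        ← Finset.mul_sum, Finset.sum_comm]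
      congr 1
      rw [← hcard, ← sum_mem_code, ← sum_mem_code, Finset.sum_mul, Finset.sum_mul,
        Finset.sum_filter, ← Finset.sum_add_distrib, ← Finset.sum_sub_distrib]
      refine Finset.sum_congr rfl fun v _ => ?_
      rw [← hsplit, ← sum_nonzero_directions]
      by_cases hv : v ∈ dualCode C
      · simp only [hv, if_true]
      · simp only [hv, if_false, Finset.sum_const_zero]
    simp only [LinearMap.smul_apply, LinearMap.sum_apply, Pi.smul_apply, Finset.sum_apply,
      Pi.add_apply, smul_eq_mul]
    rw [hsum, averageEigenvalue, mul_inv]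
    ring

/-! ### Invariant tensors are spanned by self-dual codes -/

/-- The span of the tensors of the admissible codes that are self-dual or have at least `c`
elements. -/
noncomputable def admissibleSpan (k m c : ℕ) :
    Submodule ℝ ((Fin (2 * k) → Fin m → ZMod 2) → ℝ) :=
  Submodule.span ℝ (codeTensor m '' {C : Submodule (ZMod 2) (Fin (2 * k) → ZMod 2) |
    IsAdmissible C ∧ (dualCode C = C ∨ c ≤ Nat.card C)})

theorem codeTensor_mem_admissibleSpan {k : ℕ} (m : ℕ) {c : ℕ}
    {C : Submodule (ZMod 2) (Fin (2 * k) → ZMod 2)} (hC : IsAdmissible C)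
    (h : dualCode C = C ∨ c ≤ Nat.card C) : codeTensor m C ∈ admissibleSpan k m c :=
  Submodule.subset_span ⟨C, ⟨hC, h⟩, rfl⟩

/-- T - λ, with λ the eigenvalue for size c, removes the codes of size exactly c that are not
self-dual, and keeps the tensors of self-dual codes since T fixes them. It multiplies `F` by 1 - λ ≠
0, which can be divided out. -/
theorem IsCliffordInvariant.mem_admissibleSpan_succ {k m c : ℕ} (hm : 1 ≤ m)
    {F : (Fin (2 * k) → Fin m → ZMod 2) → ℝ} (hF : IsCliffordInvariant F)
    (hc : 1 ≤ c) (hck : c < 2 ^ k) (h : F ∈ admissibleSpan k m c) :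
    F ∈ admissibleSpan k m (c + 1) := by
  classical
  obtain ⟨T, hT, hTC⟩ := exists_averaged_hadamard k hm
  have key : ∀ x ∈ admissibleSpan k m c,
      T x - averageEigenvalue k m c • x ∈ admissibleSpan k m (c + 1) := by
    intro x hx
    induction hx using Submodule.span_induction with
    | mem x hx =>
      obtain ⟨C, ⟨hC, hCc⟩, rfl⟩ := hx
      by_cases hd : dualCode C = C
      · rw [hT _ fun g hg => kron_mulVec_codeTensor hm hd hg]
        have := codeTensor_mem_admissibleSpan m (c := c + 1) hC (Or.inl hd)
        exact Submodule.sub_mem _ this (Submodule.smul_mem _ _ this)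
      · replace hCc := hCc.resolve_left hd
        rw [hTC C hC, add_sub_right_comm, ← sub_smul]
        refine Submodule.add_mem _ ?_ (Submodule.smul_mem _ _ (Submodule.sum_mem _ ?_))
        · rcases hCc.eq_or_lt with h | h
          · rw [← h, sub_self, zero_smul]
            exact Submodule.zero_mem _
          · exact Submodule.smul_mem _ _ (codeTensor_mem_admissibleSpan m hC (Or.inr h))
        · intro v hv
          rw [Finset.mem_filter] at hv
          exact codeTensor_mem_admissibleSpan m (isAdmissible_sup_span hC hv.2.1)
            (Or.inr (hCc.trans_lt (card_lt_card_sup_span hv.2.2)))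
    | zero => simp
    | add x y _ _ hx hy =>
      rw [map_add, smul_add, add_sub_add_comm]
      exact Submodule.add_mem _ hx hy
    | smul a x _ hx =>
      rw [map_smul, smul_comm, ← smul_sub]
      exact Submodule.smul_mem _ _ hx
  have h1 := key F h
  rw [hT F hF] at h1
  have h2 : F - averageEigenvalue k m c • F = (1 - averageEigenvalue k m c) • F := by
    rw [sub_smul, one_smul]
  rw [h2] at h1
  exact (Submodule.smul_mem_iff _ (sub_pos.mpr (averageEigenvalue_lt_one hm hc hck)).ne').mp h1

theorem dualCode_eq_of_card_le {k : ℕ} {C : Submodule (ZMod 2) (Fin (2 * k) → ZMod 2)}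
    (hC : C ≤ dualCode C) (h : 2 ^ k ≤ Nat.card C) : dualCode C = C := by
  have h1 := card_mul_card_dualCode C
  have h2 : Nat.card (dualCode C) ≤ Nat.card C := by
    refine le_trans ?_ h
    have h2 : 2 ^ (2 * k) = 2 ^ k * 2 ^ k := by rw [two_mul, pow_add]
    rw [h2] at h1
    by_contra! h3
    exact h1.not_gt (Nat.mul_lt_mul_of_le_of_lt h h3 Nat.card_pos)
  have h3 : (C : Set (Fin (2 * k) → ZMod 2)) = dualCode C :=
    Set.eq_of_subset_of_ncard_le hC h2 (Set.toFinite _)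
  exact (SetLike.coe_injective h3).symm

theorem card_of_dualCode_eq {k : ℕ} {C : Submodule (ZMod 2) (Fin (2 * k) → ZMod 2)}
    (hC : dualCode C = C) : Nat.card C = 2 ^ k := by
  have h := card_mul_card_dualCode C
  have h2 : 2 ^ (2 * k) = (2 ^ k) ^ 2 := by rw [← pow_mul, mul_comm]
  rw [hC, h2, ← sq] at h
  exact Nat.pow_left_injective (n := 2) (by norm_num) h

theorem IsCliffordInvariant.mem_span_selfDual {k m : ℕ} (hm : 1 ≤ m)
    {F : (Fin (2 * k) → Fin m → ZMod 2) → ℝ} (hF : IsCliffordInvariant F) :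
    F ∈ Submodule.span ℝ (Set.range fun C : SelfDualCode (2 * k) => codeTensor m C.1) := by
  have h : ∀ c, 1 ≤ c → c ≤ 2 ^ k → F ∈ admissibleSpan k m c := by
    intro c hc
    induction c, hc using Nat.le_induction with
    | base =>
      intro _
      have hsub : {C : Submodule (ZMod 2) (Fin (2 * k) → ZMod 2) | IsAdmissible C} ⊆
          {C | IsAdmissible C ∧ (dualCode C = C ∨ 1 ≤ Nat.card C)} :=
        fun C hC => ⟨hC, Or.inr Nat.card_pos⟩
      exact Submodule.span_mono (Set.image_mono hsub) (hF.mem_span_isAdmissible hm)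
    | succ c hc ih => exact fun hck => hF.mem_admissibleSpan_succ hm hc hck (ih (by omega))
  -- A self-orthogonal code with at least 2^k words is self-dual.
  refine Submodule.span_mono ?_ (h (2 ^ k) Nat.one_le_two_pow le_rfl)
  rintro _ ⟨C, ⟨hC, hCc⟩, rfl⟩
  exact ⟨⟨C, hCc.elim id (dualCode_eq_of_card_le hC.2)⟩, rfl⟩

/-! ### Polynomials and symmetric tensors -/

/-- The exponent vector of the monomial `∏ n, X (M n)`. -/
noncomputable def exponent {N : ℕ} {ι : Type*} (M : Fin N → ι) : ι →₀ ℕ :=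
  ∑ n, Finsupp.single (M n) 1

theorem prod_X_eq_monomial {N : ℕ} {ι : Type*} (M : Fin N → ι) :
    ∏ n, (X (M n) : MvPolynomial ι ℝ) = monomial (exponent M) 1 := by
  simp only [X, exponent, monomial_sum_one]

theorem exponent_comp {N : ℕ} {ι : Type*} (M : Fin N → ι) (s : Equiv.Perm (Fin N)) :
    exponent (M ∘ s) = exponent M :=
  Equiv.sum_comp s fun n => Finsupp.single (M n) 1

/-- Equal exponents mean fibres of equal size, which can be matched by bijections. -/
theorem exists_perm_of_exponent_eq {N : ℕ} {ι : Type*} {M M' : Fin N → ι}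
    (h : exponent M = exponent M') : ∃ s : Equiv.Perm (Fin N), M' = M ∘ s := by
  classical
  have hcard : ∀ (M : Fin N → ι) f, exponent M f = Fintype.card {n // M n = f} := by
    intro M f
    simp [exponent, Finsupp.finsetSum_apply, Finsupp.single_apply, Fintype.card_subtype]
  have e : ∀ f, Nonempty ({n // M' n = f} ≃ {n // M n = f}) := fun f => by
    rw [← Fintype.card_eq, ← hcard, ← hcard, h]
  refine ⟨(Equiv.sigmaFiberEquiv M').symm.trans
    ((Equiv.sigmaCongrRight fun f => (e f).some).trans (Equiv.sigmaFiberEquiv M)), ?_⟩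
  funext n
  exact (((e (M' n)).some ⟨n, rfl⟩).2).symm

theorem exists_exponent_eq {N : ℕ} {ι : Type*} {d : ι →₀ ℕ} (hd : d.degree = N) :
    ∃ M : Fin N → ι, exponent M = d := by
  classical
  obtain ⟨l, hl⟩ := Quot.exists_rep (Finsupp.toMultiset d)
  have hlen : l.length = N := by
    rw [← hd]
    exact (congrArg Multiset.card hl).trans (Finsupp.card_toMultiset d)
  subst hlen
  refine ⟨l.get, Multiset.toFinsupp.symm.injective (?_ : Finsupp.toMultiset _ = Finsupp.toMultiset d)⟩
  rw [exponent, map_sum, ← hl]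
  simp only [Finsupp.toMultiset_single, one_smul]
  have h := Multiset.sum_map_singleton ((Finset.univ : Finset (Fin l.length)).val.map l.get)
  rw [Multiset.map_map] at h
  refine h.trans ?_
  rw [Fin.univ_val_map, List.ofFn_get]
  rfl

/-- The polynomial `∑ M, F M • ∏ n, X (M n)`, the image of a tensor in the symmetric algebra. -/
noncomputable def tensorPoly {N : ℕ} {ι : Type*} [Fintype ι] :
    ((Fin N → ι) → ℝ) →ₗ[ℝ] MvPolynomial ι ℝ where
  toFun F := ∑ M, F M • ∏ n, X (M n)
  map_add' F G := by simp [add_smul, Finset.sum_add_distrib]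
  map_smul' a F := by simp [Finset.smul_sum, mul_smul]

theorem tensorPoly_apply {N : ℕ} {ι : Type*} [Fintype ι] (F : (Fin N → ι) → ℝ) :
    tensorPoly F = ∑ M, F M • ∏ n, (X (M n) : MvPolynomial ι ℝ) := rfl

theorem coeff_tensorPoly {N : ℕ} {ι : Type*} [Fintype ι] [DecidableEq ι]
    (F : (Fin N → ι) → ℝ) (d : ι →₀ ℕ) :
    coeff d (tensorPoly F) = ∑ M with exponent M = d, F M := by
  rw [tensorPoly_apply, coeff_sum, Finset.sum_filter]
  simp [prod_X_eq_monomial, coeff_monomial]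

theorem tensorPoly_isHomogeneous {N : ℕ} {ι : Type*} [Fintype ι] (F : (Fin N → ι) → ℝ) :
    (tensorPoly F).IsHomogeneous N := by
  refine IsHomogeneous.sum _ _ _ fun M _ => ?_
  rw [smul_eq_C_mul]
  have h := IsHomogeneous.prod Finset.univ (fun n => (X (M n) : MvPolynomial ι ℝ)) (fun _ => 1)
    fun n _ => isHomogeneous_X _ _
  simpa using (isHomogeneous_C ι (F M)).mul h

theorem matrixAct_tensorPoly {N : ℕ} {ι : Type*} [Fintype ι] (A : Matrix ι ι ℝ)
    (F : (Fin N → ι) → ℝ) :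
    matrixAct A (tensorPoly F) = tensorPoly ((kron fun _ => A) *ᵥ F) := by
  have h : ∀ M : Fin N → ι, matrixAct A (∏ n, X (M n)) =
      ∑ M', (kron fun _ => A) M' M • ∏ n, (X (M' n) : MvPolynomial ι ℝ) := by
    intro M
    simp only [matrixAct, map_prod, aeval_X]
    rw [Finset.prod_univ_sum, Fintype.piFinset_univ]
    refine Finset.sum_congr rfl fun M' _ => ?_
    rw [Finset.prod_mul_distrib, smul_eq_C_mul, kron_apply, map_prod]
  rw [tensorPoly_apply, tensorPoly_apply]
  simp only [map_sum, map_smul, h, Matrix.mulVec, dotProduct, Finset.smul_sum, Finset.sum_smul,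
    smul_smul]
  rw [Finset.sum_comm]
  simp only [mul_comm]

theorem tensorPoly_comp_perm {N : ℕ} {ι : Type*} [Fintype ι] (F : (Fin N → ι) → ℝ)
    (s : Equiv.Perm (Fin N)) : tensorPoly (fun M => F (M ∘ s)) = tensorPoly F := by
  refine Fintype.sum_equiv (Equiv.arrowCongr s⁻¹ (Equiv.refl ι)) _ _ fun M => ?_
  exact congrArg (F (M ∘ s) • ·)
    (Equiv.prod_comp s fun n => (X (M n) : MvPolynomial ι ℝ)).symm

/-- The coefficient at the monomial of `M` is F(M) times the number of rearrangements of `M`, a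
positive integer. -/
theorem eq_of_tensorPoly_eq {N : ℕ} {ι : Type*} [Fintype ι] {F G : (Fin N → ι) → ℝ}
    (hF : ∀ M (s : Equiv.Perm (Fin N)), F (M ∘ s) = F M)
    (hG : ∀ M (s : Equiv.Perm (Fin N)), G (M ∘ s) = G M) (h : tensorPoly F = tensorPoly G) :
    F = G := by
  classical
  have key : ∀ H : (Fin N → ι) → ℝ, (∀ M (s : Equiv.Perm (Fin N)), H (M ∘ s) = H M) → ∀ M,
      coeff (exponent M) (tensorPoly H) =
        (Finset.univ.filter fun M' : Fin N → ι => exponent M' = exponent M).card * H M := by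
    intro H hH M
    rw [coeff_tensorPoly, ← nsmul_eq_mul, ← Finset.sum_const]
    refine Finset.sum_congr rfl fun M' hM' => ?_
    obtain ⟨s, rfl⟩ := exists_perm_of_exponent_eq (Finset.mem_filter.mp hM').2.symm
    exact hH M s
  funext M
  have h1 := key F hF M
  rw [h, key G hG M] at h1
  refine (mul_left_cancel₀ ?_ h1).symm
  exact_mod_cast (Finset.card_pos.mpr ⟨M, by simp⟩).ne'

theorem exists_symmetric_tensor {N : ℕ} {ι : Type*} [Fintype ι] {p : MvPolynomial ι ℝ}
    (hp : p.IsHomogeneous N) : ∃ F : (Fin N → ι) → ℝ,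
      (∀ M (s : Equiv.Perm (Fin N)), F (M ∘ s) = F M) ∧ tensorPoly F = p := by
  classical
  refine ⟨fun M => coeff (exponent M) p /
    (Finset.univ.filter fun M' : Fin N → ι => exponent M' = exponent M).card,
    fun M s => by simp only [exponent_comp], ?_⟩
  ext d
  rw [coeff_tensorPoly]
  by_cases hd : ∃ M : Fin N → ι, exponent M = d
  · obtain ⟨M, rfl⟩ := hd
    rw [Finset.sum_congr rfl (g := fun _ => coeff (exponent M) p /
      (Finset.univ.filter fun M' : Fin N → ι => exponent M' = exponent M).card)
      fun M' hM' => by rw [(Finset.mem_filter.mp hM').2], Finset.sum_const, nsmul_eq_mul]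
    refine mul_div_cancel₀ _ ?_
    exact_mod_cast (Finset.card_pos.mpr ⟨M, by simp⟩).ne'
  · rw [Finset.sum_eq_zero fun M hM => absurd ⟨M, (Finset.mem_filter.mp hM).2⟩ hd]
    by_contra h
    refine hd (exists_exponent_eq ?_)
    have := hp (Ne.symm h)
    rw [Finsupp.degree_eq_weight_one]
    exact this

theorem kron_mulVec_comp_perm {N : ℕ} {ι : Type*} [Fintype ι] (A : Matrix ι ι ℝ)
    {F : (Fin N → ι) → ℝ} (hF : ∀ M (s : Equiv.Perm (Fin N)), F (M ∘ s) = F M)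
    (M : Fin N → ι) (s : Equiv.Perm (Fin N)) :
    ((kron fun _ => A) *ᵥ F) (M ∘ s) = ((kron fun _ => A) *ᵥ F) M := by
  rw [Matrix.mulVec, dotProduct, ← Equiv.sum_comp (Equiv.arrowCongr s⁻¹ (Equiv.refl ι))]
  refine Finset.sum_congr rfl fun M' _ => ?_
  congr 1
  · exact Equiv.prod_comp s fun n => A (M n) (M' n)
  · exact hF M' s

theorem kron_submatrix_mulVec {N : ℕ} {ι κ : Type*} [Fintype ι] [Fintype κ] (e : κ ≃ ι)
    (A : Matrix ι ι ℝ) (F : (Fin N → ι) → ℝ) (M : Fin N → κ) :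
    ((kron fun _ => A.submatrix e e) *ᵥ fun M' => F (e ∘ M')) M =
      ((kron fun _ => A) *ᵥ F) (e ∘ M) := by
  rw [Matrix.mulVec, dotProduct, Matrix.mulVec, dotProduct,
    ← Equiv.sum_comp (Equiv.arrowCongr (Equiv.refl (Fin N)) e)]
  rfl

/-! ### Complete weight enumerators -/

theorem mem_extendScalars_iff {K : Type*} [Field K] [Algebra (ZMod 2) K] {m N : ℕ}
    (b : Module.Basis (Fin m) (ZMod 2) K) (C : Submodule (ZMod 2) (Fin N → ZMod 2))
    (c : Fin N → K) :
    c ∈ extendScalars K C ↔ ∀ j, (fun n => b.equivFun (c n) j) ∈ C := by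
  constructor
  · rintro ⟨t, ht, rfl⟩ j
    -- All functionals are needed, not only coordinates: multiplication by a scalar of K replaces φ
    -- by its composite with that multiplication.
    have key : ∀ φ : K →ₗ[ZMod 2] ZMod 2,
        (fun n => φ (TensorProduct.piScalarRight (ZMod 2) K K (Fin N) t n)) ∈ C := by
      rw [SetLike.mem_coe, Submodule.baseChange_eq_span] at ht
      induction ht using Submodule.span_induction with
      | mem x hx =>
        obtain ⟨y, hy, rfl⟩ := hx
        intro φ
        have : (fun n => φ (TensorProduct.piScalarRight (ZMod 2) K K (Fin N)
            (TensorProduct.mk (ZMod 2) K (Fin N → ZMod 2) 1 y) n)) = φ 1 • y := by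
          funext n
          simp [mul_comm]
        rw [this]
        exact C.smul_mem _ hy
      | zero =>
        intro φ
        simp only [map_zero, Pi.zero_apply]
        exact C.zero_mem
      | add x y _ _ hx hy =>
        intro φ
        simp only [map_add, Pi.add_apply]
        exact C.add_mem (hx φ) (hy φ)
      | smul a x _ hx =>
        intro φ
        simpa using hx (φ.comp (LinearMap.mulLeft (ZMod 2) a))
    exact key (b.coord j)
  · intro h
    have hc : c = ∑ j, b j • fun n => algebraMap (ZMod 2) K (b.equivFun (c n) j) := by
      funext n
      rw [Finset.sum_apply]
      conv_lhs => rw [← b.sum_equivFun (c n)]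
      refine Finset.sum_congr rfl fun j _ => ?_
      simp [Algebra.smul_def, mul_comm]
    rw [hc]
    refine Submodule.sum_mem _ fun j _ => Submodule.smul_mem _ _
      ⟨1 ⊗ₜ[ZMod 2] fun n => b.equivFun (c n) j, Submodule.tmul_mem_baseChange_of_mem 1 (h j), ?_⟩
    funext n
    simp [Algebra.smul_def]

/-- The polynomial in the variables `x_f`, `f ∈ K`, of a tensor over `𝔽₂^m`. -/
noncomputable def basisPoly {K : Type*} [Field K] [Fintype K] [Algebra (ZMod 2) K] {m : ℕ}
    (b : Module.Basis (Fin m) (ZMod 2) K) (N : ℕ) :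
    ((Fin N → Fin m → ZMod 2) → ℝ) →ₗ[ℝ] MvPolynomial K ℝ :=
  tensorPoly.comp (LinearMap.funLeft ℝ ℝ fun M => b.equivFun ∘ M)

theorem cwe_extendScalars {K : Type*} [Field K] [Fintype K] [Algebra (ZMod 2) K] {m N : ℕ}
    (b : Module.Basis (Fin m) (ZMod 2) K) (C : Submodule (ZMod 2) (Fin N → ZMod 2)) :
    cwe (extendScalars K C) = basisPoly b N (codeTensor m C) := by
  classical
  rw [cwe, basisPoly, LinearMap.comp_apply, tensorPoly_apply, Finset.sum_filter]
  refine Finset.sum_congr rfl fun c _ => ?_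
  have h1 : ∏ f : K, (X f : MvPolynomial K ℝ) ^ Nat.card {i : Fin N // c i = f} =
      ∏ n, X (c n) := by
    rw [← Finset.prod_fiberwise' Finset.univ c]
    refine Finset.prod_congr rfl fun f _ => ?_
    rw [Finset.prod_const, Nat.card_eq_fintype_card, Fintype.card_subtype]
  rw [h1, LinearMap.funLeft_apply]
  have h2 := mem_extendScalars_iff b C c
  by_cases h : c ∈ extendScalars K C
  · have h3 : codeTensor m C (b.equivFun ∘ c) = 1 := if_pos (h2.mp h)
    rw [if_pos h, h3, one_smul]
  · have h3 : codeTensor m C (b.equivFun ∘ c) = 0 := if_neg fun h' => h (h2.mpr h')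
    rw [if_neg h, h3, zero_smul]

theorem basisPoly_mem_cliffordInvariants {K : Type*} [Field K] [Fintype K] [Algebra (ZMod 2) K]
    {m N : ℕ} (b : Module.Basis (Fin m) (ZMod 2) K) {F : (Fin N → Fin m → ZMod 2) → ℝ}
    (hF : IsCliffordInvariant F) : basisPoly b N F ∈ cliffordInvariants b N := by
  refine ⟨tensorPoly_isHomogeneous _, fun g hg => ?_⟩
  rw [basisPoly, LinearMap.comp_apply, matrixAct_tensorPoly]
  congr 1
  funext M
  exact (kron_submatrix_mulVec b.equivFun.toEquiv g.1 F M).trans (congrFun (hF g hg) _)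

/-- The symmetric tensor lifting an invariant polynomial is unique, and its image under a Clifford
element is again a symmetric lift; hence the tensor is itself invariant. -/
theorem exists_basisPoly_eq {K : Type*} [Field K] [Fintype K] [Algebra (ZMod 2) K]
    {m N : ℕ} (b : Module.Basis (Fin m) (ZMod 2) K) {p : MvPolynomial K ℝ}
    (hp : p ∈ cliffordInvariants b N) : ∃ F, IsCliffordInvariant F ∧ basisPoly b N F = p := by
  obtain ⟨F, hF, rfl⟩ := exists_symmetric_tensor hp.1
  have hG : (fun M : Fin N → K => (fun M' : Fin N → Fin m → ZMod 2 =>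
      F (b.equivFun.symm ∘ M')) (b.equivFun.toEquiv ∘ M)) = F := by
    funext M
    refine congrArg F (funext fun n => ?_)
    exact b.equivFun.symm_apply_apply (M n)
  refine ⟨fun M => F (b.equivFun.symm ∘ M), fun g hg => ?_, congrArg tensorPoly hG⟩
  have h1 := hp.2 g hg
  rw [matrixAct_tensorPoly] at h1
  have h2 := eq_of_tensorPoly_eq (kron_mulVec_comp_perm _ hF) hF h1
  funext M
  have h3 := kron_submatrix_mulVec b.equivFun.toEquiv g.1
    (fun M' : Fin N → Fin m → ZMod 2 => F (b.equivFun.symm ∘ M')) (b.equivFun.symm ∘ M)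
  rw [hG] at h3
  have h4 : (b.equivFun.toEquiv ∘ b.equivFun.symm ∘ M) = M := by
    funext n
    exact b.equivFun.apply_symm_apply (M n)
  rw [h4] at h3
  exact h3.symm.trans (congrFun h2 _)

/-! ### Linear independence -/

theorem basisPoly_codeTensor_eq_of_equivalent {K : Type*} [Field K] [Fintype K]
    [Algebra (ZMod 2) K] {m N : ℕ} (b : Module.Basis (Fin m) (ZMod 2) K) {C D : SelfDualCode N}
    (h : (codeEquivalence N).r C D) :
    basisPoly b N (codeTensor m C.1) = basisPoly b N (codeTensor m D.1) := by
  classical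
  obtain ⟨s, hs⟩ := h
  rw [basisPoly, LinearMap.comp_apply, LinearMap.comp_apply,
    ← tensorPoly_comp_perm (LinearMap.funLeft ℝ ℝ (fun M => b.equivFun ∘ M) (codeTensor m D.1)) s]
  congr 1
  funext M
  exact if_congr (forall_congr' fun j => hs _) rfl rfl

theorem exists_span_range_eq_top {K V : Type*} [Field K] [AddCommGroup V] [Module K V]
    [FiniteDimensional K V] {m : ℕ} (h : Module.finrank K V ≤ m) :
    ∃ u : Fin m → V, Submodule.span K (Set.range u) = ⊤ := by
  refine ⟨fun j => if hj : j.1 < Module.finrank K V then Module.finBasis K V ⟨j, hj⟩ else 0, ?_⟩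
  rw [eq_top_iff, ← (Module.finBasis K V).span_eq, Submodule.span_le]
  rintro _ ⟨i, rfl⟩
  exact Submodule.subset_span ⟨⟨i, i.2.trans_le h⟩, dif_pos i.2⟩

/-- The all-ones word is generated for free, so only C/⟨1⟩ must be spanned by m columns. Its
dimension k - 1 (for k > 0) is the source of the bound on m. -/
theorem exists_columnCode_eq {k m : ℕ} (hkm : k ≤ m + 1)
    {C : Submodule (ZMod 2) (Fin (2 * k) → ZMod 2)} (hC : dualCode C = C) :
    ∃ M : Fin (2 * k) → Fin m → ZMod 2, columnCode M = C := by
  have h1 := one_mem_of_dualCode_eq hC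
  set L := Submodule.span (ZMod 2) {(⟨1, h1⟩ : C)} with hL
  have hk : Module.finrank (ZMod 2) C = k := by
    have h := card_of_dualCode_eq hC
    rw [Module.natCard_eq_pow_finrank (K := ZMod 2), Nat.card_zmod] at h
    exact Nat.pow_right_injective le_rfl h
  have hr : Module.finrank (ZMod 2) (C ⧸ L) ≤ m := by
    have h := L.finrank_quotient_add_finrank
    rw [hk] at h
    -- In length 0 the all-ones word is zero and spans no line.
    rcases Nat.eq_zero_or_pos k with rfl | hpos
    · omega
    · have : Module.finrank (ZMod 2) L = 1 := by
        refine finrank_span_singleton fun h0 => ?_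
        have := congrFun (congrArg Subtype.val h0) ⟨0, by omega⟩
        exact one_ne_zero this
      omega
  obtain ⟨u, hu⟩ := exists_span_range_eq_top hr
  choose w hw using fun j => L.mkQ_surjective (u j)
  refine ⟨fun n j => (w j).1 n, le_antisymm ?_ fun c hc => ?_⟩
  · rw [columnCode_le_iff h1]
    exact fun j => (w j).2
  · have h2 : L.mkQ ⟨c, hc⟩ ∈ Submodule.span (ZMod 2) (Set.range u) := hu ▸ Submodule.mem_top
    obtain ⟨a, ha⟩ := (Submodule.mem_span_range_iff_exists_fun _).mp h2
    simp only [← hw, ← map_smul, ← map_sum] at ha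
    rw [Submodule.mkQ_apply, Submodule.mkQ_apply, eq_comm, Submodule.Quotient.eq, hL,
      Submodule.mem_span_singleton] at ha
    obtain ⟨t, ht⟩ := ha
    have h3 : c = t • 1 + ∑ j, a j • (w j).1 := by
      have := congrArg Subtype.val ht
      simp only [Submodule.coe_smul, AddSubgroupClass.coe_sub, Submodule.coe_sum] at this
      rw [this, sub_add_cancel]
    rw [h3]
    exact Submodule.add_mem _ (Submodule.smul_mem _ _ (one_mem_columnCode _))
      (Submodule.sum_mem _ fun j _ => Submodule.smul_mem _ _
        (Submodule.subset_span (Set.mem_insert_of_mem _ ⟨j, rfl⟩)))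

/-- A nonzero value means that the permuted C lies in D; taking duals reverses the inclusion, so the
two are equal. -/
theorem equivalent_of_codeTensor_ne_zero {N m : ℕ} {C D : SelfDualCode N}
    {M : Fin N → Fin m → ZMod 2} (hM : columnCode M = C.1) (s : Equiv.Perm (Fin N))
    (h : codeTensor m D.1 (M ∘ s) ≠ 0) : (codeEquivalence N).r C D := by
  have hD : ∀ j, (fun n => (M ∘ s) n j) ∈ D.1 := by
    by_contra hD
    exact h (if_neg hD)
  have hle : C.1 ≤ D.1.comap (LinearMap.funLeft (ZMod 2) (ZMod 2) s) := by
    have h1 : 1 ∈ D.1 := one_mem_of_dualCode_eq D.2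
    have h2 : 1 ∈ D.1.comap (LinearMap.funLeft (ZMod 2) (ZMod 2) s) := h1
    rw [← hM, columnCode_le_iff h2]
    exact hD
  refine ⟨s, fun c => ⟨fun hc => hle hc, fun hc => ?_⟩⟩
  rw [← C.2]
  intro c' hc'
  rw [← D.2] at hc
  have h1 := hc _ (hle hc')
  rw [← h1]
  exact (Equiv.sum_comp s fun n => c' n * c n).symm

theorem coeff_basisPoly {K : Type*} [Field K] [Fintype K] [Algebra (ZMod 2) K] {m N : ℕ}
    (b : Module.Basis (Fin m) (ZMod 2) K) (F : (Fin N → Fin m → ZMod 2) → ℝ)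
    (d : K →₀ ℕ) [DecidableEq K] :
    coeff d (basisPoly b N F) = ∑ M with exponent M = d, F (b.equivFun ∘ M) :=
  coeff_tensorPoly _ _

/-- For `M` generating the representative of a class, the coefficient of the monomial of `M` is
positive in that enumerator and zero in those of all other classes. -/
theorem linearIndependent_basisPoly {K : Type*} [Field K] [Fintype K] [Algebra (ZMod 2) K]
    {m k : ℕ} (b : Module.Basis (Fin m) (ZMod 2) K) (hkm : k ≤ m + 1) :
    LinearIndependent ℝ fun q : Quotient (codeEquivalence (2 * k)) =>
      basisPoly b (2 * k) (codeTensor m q.out.1) := by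
  classical
  rw [linearIndependent_iff']
  intro S a ha q hq
  obtain ⟨M, hM⟩ := exists_columnCode_eq hkm q.out.2
  have h := congrArg (coeff (exponent (b.equivFun.symm ∘ M))) ha
  rw [coeff_sum, coeff_zero, Finset.sum_eq_single q] at h
  · rw [coeff_smul, smul_eq_mul] at h
    refine (mul_eq_zero.mp h).resolve_right (ne_of_gt ?_)
    rw [coeff_basisPoly]
    refine Finset.sum_pos' (fun _ _ => codeTensor_nonneg _ _)
      ⟨b.equivFun.symm ∘ M, by simp, ?_⟩
    have h4 : b.equivFun ∘ b.equivFun.symm ∘ M = M := by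
      funext n
      exact b.equivFun.apply_symm_apply (M n)
    rw [h4, codeTensor, if_pos]
    · exact one_pos
    · rw [← columnCode_le_iff (one_mem_of_dualCode_eq q.out.2), hM]
  · intro r _ hr
    rw [coeff_smul, smul_eq_mul, coeff_basisPoly, Finset.sum_eq_zero, mul_zero]
    intro M' hM'
    obtain ⟨s, rfl⟩ := exists_perm_of_exponent_eq (Finset.mem_filter.mp hM').2.symm
    have h4 : b.equivFun ∘ (b.equivFun.symm ∘ M) ∘ s = M ∘ s := by
      funext n
      exact b.equivFun.apply_symm_apply (M (s n))
    rw [h4]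
    by_contra hne
    refine hr ?_
    rw [← Quotient.out_eq r, ← Quotient.out_eq q]
    exact (Quotient.sound (equivalent_of_codeTensor_ne_zero hM s hne)).symm
  · exact fun h => absurd hq h

end RealClifford

/-! ### The main theorem -/

theorem mainTheorem1 (k m : ℕ) (hm : 1 ≤ m)
    (K : Type*) [Field K] [Fintype K] [Algebra (ZMod 2) K]
    (b : Module.Basis (Fin m) (ZMod 2) K) :
    Submodule.span ℝ (Set.range fun C : RealClifford.SelfDualCode (2 * k) =>
        RealClifford.cwe (RealClifford.extendScalars K C.1)) =
      RealClifford.cliffordInvariants b (2 * k) ∧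
    ((k : ℤ) - 1 ≤ (m : ℤ) →
      ∃ B : Module.Basis (Quotient (RealClifford.codeEquivalence (2 * k))) ℝ
          (RealClifford.cliffordInvariants b (2 * k)),
        ∀ C : RealClifford.SelfDualCode (2 * k),
          (B (Quotient.mk (RealClifford.codeEquivalence (2 * k)) C) : MvPolynomial K ℝ) =
            RealClifford.cwe (RealClifford.extendScalars K C.1)) := by
  simp only [RealClifford.cwe_extendScalars b]
  have hspan : Submodule.span ℝ (Set.range fun C : RealClifford.SelfDualCode (2 * k) =>
      RealClifford.basisPoly b (2 * k) (RealClifford.codeTensor m C.1)) =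
      RealClifford.cliffordInvariants b (2 * k) := by
    apply le_antisymm
    · rw [Submodule.span_le]
      rintro _ ⟨C, rfl⟩
      exact RealClifford.basisPoly_mem_cliffordInvariants b fun g hg =>
        RealClifford.kron_mulVec_codeTensor hm C.2 hg
    · intro p hp
      obtain ⟨F, hF, rfl⟩ := RealClifford.exists_basisPoly_eq b hp
      have h := Submodule.mem_map_of_mem (f := RealClifford.basisPoly b (2 * k))
        (hF.mem_span_selfDual hm)
      rwa [Submodule.map_span, ← Set.range_comp] at h
  refine ⟨hspan, fun hkm => ?_⟩
  -- The basis is built from chosen representatives; the enumerator does not depend on the choice.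
  have heq : ∀ C : RealClifford.SelfDualCode (2 * k), RealClifford.basisPoly b (2 * k)
      (RealClifford.codeTensor m
        (Quotient.mk (RealClifford.codeEquivalence (2 * k)) C).out.1) =
      RealClifford.basisPoly b (2 * k) (RealClifford.codeTensor m C.1) := fun C =>
    RealClifford.basisPoly_codeTensor_eq_of_equivalent b (Quotient.mk_out C)
  have hspan' : Submodule.span ℝ (Set.range fun q : Quotient
      (RealClifford.codeEquivalence (2 * k)) =>
      RealClifford.basisPoly b (2 * k) (RealClifford.codeTensor m q.out.1)) =
      RealClifford.cliffordInvariants b (2 * k) := by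
    rw [← hspan]
    congr 1
    ext p
    constructor
    · rintro ⟨q, rfl⟩
      exact ⟨q.out, rfl⟩
    · rintro ⟨C, rfl⟩
      exact ⟨Quotient.mk _ C, heq C⟩
  refine ⟨(Module.Basis.span (RealClifford.linearIndependent_basisPoly b (by omega))).map
    (LinearEquiv.ofEq _ _ hspan'), fun C => ?_⟩
  rw [Module.Basis.map_apply, LinearEquiv.coe_ofEq_apply, Module.Basis.span_apply]
  exact heq C
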